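/- Throughout, matroids have finite ground sets, groups are finite, and representations are finite-dimensional over $\mathbb{Q}$. For a finite group $W$, let $\operatorname{VRep}(W)$ be the Grothendieck ring of isomorphism classes of $W$-representations (sum $=\oplus$, product $=\otimes$), whose elements are called virtual representations, and let $\tau_W=1$ be the class of the trivial representation. Induction, and restriction along a group homomorphism, are applied to polynomials over $\operatorname{VRep}$ coefficient by coefficient. Let $M$ be a matroid on the ground set $E$ and let $W$ act on $E$ preserving the set of bases of $M$. For $S\subseteq E$ let $M^S$ be the restriction of $M$ to $S$, let $M_S$ be the contraction of $M$ by $S$ (with ground set $E\setminus S$), and let $W_S\subseteq W$ be the stabilizer of $S$, which acts on $M^S$ and $M_S$. The equivariant Kazhdan–Lusztig polynomial $P_M^W(t)$, the equivariant $Z$-polynomial $Z_M^W(t)$ and the equivariant inverse Kazhdan–Lusztig polynomial $Q_M^W(t)$, all in $\operatorname{VRep}(W)[t]$, are the polynomials characterized by the following conditions: * if $E=\emptyset$, then $P_M^W=Z_M^W=Q_M^W=\tau_W$; * if $E\neq\emptyset$, then $\deg P_M^W<\tfrac12\operatorname{rk}M$; * $t^{\operatorname{rk}M}Z_M^W(t^{-1})=Z_M^W(t)$,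 and $Z_M^W(t)=\sum_{[S]\in 2^E/W}t^{\operatorname{rk}S}\operatorname{Ind}_{W_S}^W P_{M_S}^{W_S}(t)$; * if $E\neq\emptyset$, then $\sum_{[S]\in 2^E/W}(-1)^{\operatorname{rk}S}\operatorname{Ind}_{W_S}^W\big(Q_{M^S}^{W_S}(t)\otimes P_{M_S}^{W_S}(t)\big)=0$. A hyperplane (maximal proper flat) $H$ of a matroid $M$ of rank $k$ is *stressed* if every $k$-element subset of $H$ is a circuit. Then every member of the $W$-orbit of $H$ is a stressed hyperplane, and there is a matroid $\tilde M$ on $E$, preserved by $W$, whose bases are the bases of $M$ together with all $k$-element subsets of the members of the $W$-orbit of $H$. Let $W_H$ be the stabilizer of $H$ in $W$. If $|H|=h$, then an ordering of $H$ gives a homomorphism $W_H\to\mathfrak{S}_h$; write $\operatorname{Res}_{W_H}^{\mathfrak{S}_h}$ for the pullback along it. **Theorem.** Fix integers $h\ge k\ge 1$. There exist polynomials $p_{k,h}(t),q_{k,h}(t),z_{k,h}(t)\in\operatorname{VRep}(\mathfrak{S}_h)[t]$, depending only on $k$ and $h$, such that for every matroid $M$ of rank $k$, every finite group $W$ of symmetries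 of $M$, every stressed hyperplane $H$ of $M$ of cardinality $h$, and every ordering of $H$, $$P_{\tilde M}^W(t)=P_M^W(t)+\operatorname{Ind}_{W_H}^W\operatorname{Res}_{W_H}^{\mathfrak{S}_h}p_{k,h}(t),$$ $$Q_{\tilde M}^W(t)=Q_M^W(t)+\operatorname{Ind}_{W_H}^W\operatorname{Res}_{W_H}^{\mathfrak{S}_h}q_{k,h}(t),$$ $$Z_{\tilde M}^W(t)=Z_M^W(t)+\operatorname{Ind}_{W_H}^W\operatorname{Res}_{W_H}^{\mathfrak{S}_h}z_{k,h}(t).$$ -/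

import Mathlib

universe u

open scoped Pointwise Polynomial

noncomputable section

namespace EquivariantKL

/-! ## Virtual rational representations of a finite group -/

section VirtualRep

variable {G : Type} [Group G]

/-- `V ≅ V' ⊕ V''` as rational representations of `G`. -/
def IsSum (V V' V'' : FDRep ℚ G) : Prop :=
  Nonempty (Representation.Equiv V.ρ (Representation.prod V'.ρ V''.ρ))

variable (G) in
/-- The subgroup generated by all `[V] - [V'] - [V'']` with `V ≅ V' ⊕ V''`
(in particular by all `[V] - [V']` with `V ≅ V'`). -/
def sumRelations : AddSubgroup (FreeAbelianGroup (FDRep ℚ G)) :=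
  AddSubgroup.closure {x | ∃ V V' V'' : FDRep ℚ G, IsSum V V' V'' ∧
    x = FreeAbelianGroup.of V - FreeAbelianGroup.of V' - FreeAbelianGroup.of V''}

variable (G) in
/-- The Grothendieck group of isomorphism classes of finite-dimensional rational representations
of `G` under direct sum; its elements are the virtual representations of `G`. -/
def VRep : Type 1 := FreeAbelianGroup (FDRep ℚ G) ⧸ sumRelations G

instance : AddCommGroup (VRep G) :=
  inferInstanceAs (AddCommGroup (FreeAbelianGroup (FDRep ℚ G) ⧸ sumRelations G))

namespace VRep

variable (G) in
/-- The quotient map. -/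
def proj : FreeAbelianGroup (FDRep ℚ G) →+ VRep G := QuotientAddGroup.mk' (sumRelations G)

theorem proj_surjective : Function.Surjective (proj G) :=
  QuotientAddGroup.mk'_surjective (sumRelations G)

theorem proj_eq_zero {x : FreeAbelianGroup (FDRep ℚ G)} (hx : x ∈ sumRelations G) :
    proj G x = 0 := (QuotientAddGroup.eq_zero_iff x).2 hx

/-- The class of a representation. -/
def of (V : FDRep ℚ G) : VRep G := proj G (FreeAbelianGroup.of V)

/-- The class of an unbundled finite-dimensional representation. -/
def mk {V : Type} [AddCommGroup V] [Module ℚ V] [Module.Finite ℚ V]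
    (ρ : Representation ℚ G V) : VRep G := of (FDRep.of ρ)

/-- A function on representations that is additive on direct sums extends to virtual
representations. -/
def lift {A : Type*} [AddCommGroup A] (f : FDRep ℚ G → A)
    (hf : ∀ V V' V'', IsSum V V' V'' → f V = f V' + f V'') : VRep G →+ A :=
  QuotientAddGroup.lift (sumRelations G) (FreeAbelianGroup.lift f) (by
    rw [sumRelations, AddSubgroup.closure_le]
    rintro x ⟨V, V', V'', h, rfl⟩
    simp [hf V V' V'' h])

@[simp]
theorem lift_of {A : Type*} [AddCommGroup A] (f : FDRep ℚ G → A)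
    (hf : ∀ V V' V'', IsSum V V' V'' → f V = f V' + f V'') (V : FDRep ℚ G) :
    lift f hf (of V) = f V :=
  FreeAbelianGroup.lift_apply_of f V

theorem of_eq_add {V V' V'' : FDRep ℚ G} (h : IsSum V V' V'') : of V = of V' + of V'' := by
  unfold of
  rw [← map_add, ← sub_eq_zero, ← map_sub, ← sub_sub]
  exact proj_eq_zero (AddSubgroup.subset_closure ⟨V, V', V'', h, rfl⟩)

theorem mk_eq_add {V V' V'' : Type} [AddCommGroup V] [Module ℚ V] [Module.Finite ℚ V]
    [AddCommGroup V'] [Module ℚ V'] [Module.Finite ℚ V']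
    [AddCommGroup V''] [Module ℚ V''] [Module.Finite ℚ V'']
    {ρ : Representation ℚ G V} {ρ' : Representation ℚ G V'} {ρ'' : Representation ℚ G V''}
    (e : ρ.Equiv (ρ'.prod ρ'')) : mk ρ = mk ρ' + mk ρ'' :=
  of_eq_add ⟨e⟩

theorem mk_congr {V V' : Type} [AddCommGroup V] [Module ℚ V] [Module.Finite ℚ V]
    [AddCommGroup V'] [Module ℚ V'] [Module.Finite ℚ V']
    {ρ : Representation ℚ G V} {ρ' : Representation ℚ G V'} (e : ρ.Equiv ρ') : mk ρ = mk ρ' := by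
  have h0 : mk (Representation.trivial ℚ G PUnit.{1}) = 0 := by
    have := mk_eq_add (ρ := Representation.trivial ℚ G PUnit.{1})
      (ρ' := Representation.trivial ℚ G PUnit.{1}) (ρ'' := Representation.trivial ℚ G PUnit.{1})
      (.mk (LinearEquiv.ofSubsingleton _ _) fun g => by ext)
    simpa using this
  have h1 : mk ρ = mk ρ' + mk (Representation.trivial ℚ G PUnit.{1}) :=
    mk_eq_add (e.trans (.mk (LinearEquiv.prodUnique (R := ℚ) (M := V') (M₂ := PUnit.{1})).symm
      fun g => by ext x; rfl))
  rw [h1, h0, add_zero]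

theorem of_congr {V V' : FDRep ℚ G} (e : Representation.Equiv V.ρ V'.ρ) : of V = of V' :=
  mk_congr e

@[elab_as_elim]
theorem induction_on {motive : VRep G → Prop} (x : VRep G) (zero : motive 0)
    (of : ∀ V : FDRep ℚ G, motive (of V)) (neg : ∀ x, motive x → motive (-x))
    (add : ∀ x y, motive x → motive y → motive (x + y)) : motive x := by
  obtain ⟨y, rfl⟩ := proj_surjective x
  induction y using FreeAbelianGroup.induction_on with
  | zero => rw [map_zero]; exact zero
  | of V => exact of V
  | neg V h => rw [map_neg]; exact neg _ h
  | add x y hx hy => rw [map_add]; exact add _ _ hx hy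

theorem hom_ext {A : Type*} [AddCommGroup A] {f g : VRep G →+ A}
    (h : ∀ V : FDRep ℚ G, f (of V) = g (of V)) : f = g := by
  ext x
  obtain ⟨y, rfl⟩ := proj_surjective x
  exact DFunLike.congr_fun (FreeAbelianGroup.lift_ext (f.comp (proj G)) (g.comp (proj G))
    fun V => h V) y

/-- The product of virtual representations, induced by the tensor product. -/
def mulHom : VRep G →+ VRep G →+ VRep G :=
  lift (fun V => lift (fun V' => mk (Representation.tprod V.ρ V'.ρ)) (by
      rintro U U' U'' ⟨e⟩
      refine mk_eq_add (.mk ((LinearEquiv.lTensor V e.toLinearEquiv).trans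
        (TensorProduct.prodRight ℚ ℚ V U' U'')) fun g => ?_)
      ext v u
      · simp [e.isIntertwining]
      · simp [e.isIntertwining])) (by
    rintro U U' U'' ⟨e⟩
    refine hom_ext fun V => ?_
    simp only [lift_of, AddMonoidHom.add_apply]
    refine mk_eq_add (.mk ((LinearEquiv.rTensor V e.toLinearEquiv).trans
        (TensorProduct.prodLeft ℚ ℚ U' U'' V)) fun g => ?_)
    ext u v
    · simpa [e.isIntertwining] using (by rcases e u with ⟨a, b⟩; simp)
    · simpa [e.isIntertwining] using (by rcases e u with ⟨a, b⟩; simp))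

instance : Mul (VRep G) := ⟨fun x y => mulHom x y⟩
instance : One (VRep G) := ⟨mk (Representation.trivial ℚ G ℚ)⟩

theorem mul_def (x y : VRep G) : x * y = mulHom x y := rfl

/-- The unit is the class of the trivial representation. -/
theorem one_def : (1 : VRep G) = mk (Representation.trivial ℚ G ℚ) := rfl

theorem of_mul_of (V V' : FDRep ℚ G) : of V * of V' = mk (Representation.tprod V.ρ V'.ρ) := by
  simp [mul_def, mulHom]

theorem mk_mul_mk {V V' : Type} [AddCommGroup V] [Module ℚ V] [Module.Finite ℚ V]
    [AddCommGroup V'] [Module ℚ V'] [Module.Finite ℚ V']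
    (ρ : Representation ℚ G V) (ρ' : Representation ℚ G V') : mk ρ * mk ρ' = mk (ρ.tprod ρ') :=
  of_mul_of (FDRep.of ρ) (FDRep.of ρ')

theorem of_eq_mk (V : FDRep ℚ G) : of V = mk (V := V) V.ρ := rfl

theorem mul_assoc' (x y z : VRep G) : x * y * z = x * (y * z) := by
  simp only [mul_def]
  induction x using induction_on with
  | zero => simp
  | add x x' hx hx' => simp [hx, hx']
  | neg x hx => simp [hx]
  | of U =>
  induction y using induction_on with
  | zero => simp
  | add y y' hy hy' => simp [hy, hy']
  | neg y hy => simp [hy]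
  | of V =>
  induction z using induction_on with
  | zero => simp
  | add z z' hz hz' => simp [hz, hz']
  | neg z hz => simp [hz]
  | of W =>
  simp only [← mul_def, of_eq_mk, mk_mul_mk]
  exact mk_congr (Representation.TensorProduct.assoc U.ρ V.ρ W.ρ)

/-- Direct sum is addition and tensor product is multiplication. -/
instance : CommRing (VRep G) :=
  have hcomm : ∀ x y : VRep G, x * y = y * x := fun x y => by
    have : (mulHom : VRep G →+ VRep G →+ VRep G) = mulHom.flip :=
      hom_ext fun V => hom_ext fun V' => by
        simpa [mulHom] using mk_congr (Representation.TensorProduct.comm V.ρ V'.ρ)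
    exact DFunLike.congr_fun (DFunLike.congr_fun this x) y
  have hone : ∀ x : VRep G, 1 * x = x := fun x => by
    have : mulHom (1 : VRep G) = AddMonoidHom.id (VRep G) := hom_ext fun V => by
      exact (of_mul_of _ V).trans (mk_congr (Representation.TensorProduct.lid ℚ V.ρ))
    exact DFunLike.congr_fun this x
  { (inferInstance : AddCommGroup (VRep G)) with
    mul_assoc := mul_assoc'
    one_mul := hone
    mul_one := fun x => (hcomm x 1).trans (hone x)
    mul_comm := hcomm
    left_distrib := fun x y z => map_add (mulHom x) y z
    right_distrib := fun x y z => by simp [mul_def]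
    zero_mul := fun x => by simp [mul_def]
    mul_zero := fun x => by simp [mul_def] }

variable {H : Type} [Group H]

/-- Restriction of virtual representations along a group homomorphism. -/
def res (φ : G →* H) : VRep H →+ VRep G :=
  lift (fun V => mk (V := V) (V.ρ.comp φ)) (by
    rintro V V' V'' ⟨e⟩
    exact mk_eq_add (.mk e.toLinearEquiv fun g => e.isIntertwining' (φ g)))

/-- The map of induced representations given by an equivariant map. -/
def indMap (φ : G →* H) {V V' : Type} [AddCommGroup V] [Module ℚ V] [AddCommGroup V'] [Module ℚ V']
    {ρ : Representation ℚ G V} {ρ' : Representation ℚ G V'} (f : ρ.IntertwiningMap ρ') :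
    Representation.IndV φ ρ →ₗ[ℚ] Representation.IndV φ ρ' :=
  Representation.Coinvariants.map _ _ (f.lTensor ((Representation.leftRegular ℚ H).comp φ))

@[simp]
theorem indMap_mk (φ : G →* H) {V V' : Type} [AddCommGroup V] [Module ℚ V] [AddCommGroup V']
    [Module ℚ V'] {ρ : Representation ℚ G V} {ρ' : Representation ℚ G V'}
    (f : ρ.IntertwiningMap ρ') (h : H) (v : V) :
    indMap φ f (Representation.IndV.mk φ ρ h v) = Representation.IndV.mk φ ρ' h (f v) := rfl

/-- Induction is additive on direct sums. -/
theorem ind_isSum (φ : G →* H) {V V' V'' : Type} [AddCommGroup V] [Module ℚ V]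
    [AddCommGroup V'] [Module ℚ V'] [AddCommGroup V''] [Module ℚ V'']
    {ρ : Representation ℚ G V} {ρ' : Representation ℚ G V'} {ρ'' : Representation ℚ G V''}
    (e : ρ.Equiv (ρ'.prod ρ'')) :
    Nonempty ((Representation.ind φ ρ).Equiv
      ((Representation.ind φ ρ').prod (Representation.ind φ ρ''))) := by
  let f' := (Representation.IntertwiningMap.fst ℚ ρ' ρ'').comp e.toIntertwiningMap
  let f'' := (Representation.IntertwiningMap.snd ℚ ρ' ρ'').comp e.toIntertwiningMap
  let g' := e.symm.toIntertwiningMap.comp (Representation.IntertwiningMap.inl ℚ ρ' ρ'')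
  let g'' := e.symm.toIntertwiningMap.comp (Representation.IntertwiningMap.inr ℚ ρ' ρ'')
  have h11 (x) : indMap φ f' (indMap φ g' x) = x := LinearMap.congr_fun
    (f := indMap φ f' ∘ₗ indMap φ g') (g := LinearMap.id) (Representation.IndV.hom_ext _ _ fun h =>
      LinearMap.ext fun v => congrArg (Representation.IndV.mk φ ρ' h)
        (congrArg Prod.fst (e.apply_symm_apply (v, 0)))) x
  have h12 (x) : indMap φ f' (indMap φ g'' x) = 0 := LinearMap.congr_fun
    (f := indMap φ f' ∘ₗ indMap φ g'') (g := 0) (Representation.IndV.hom_ext _ _ fun h =>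
      LinearMap.ext fun v => (congrArg (Representation.IndV.mk φ ρ' h)
        (congrArg Prod.fst (e.apply_symm_apply (0, v)))).trans (map_zero _)) x
  have h21 (x) : indMap φ f'' (indMap φ g' x) = 0 := LinearMap.congr_fun
    (f := indMap φ f'' ∘ₗ indMap φ g') (g := 0) (Representation.IndV.hom_ext _ _ fun h =>
      LinearMap.ext fun v => (congrArg (Representation.IndV.mk φ ρ'' h)
        (congrArg Prod.snd (e.apply_symm_apply (v, 0)))).trans (map_zero _)) x
  have h22 (x) : indMap φ f'' (indMap φ g'' x) = x := LinearMap.congr_fun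
    (f := indMap φ f'' ∘ₗ indMap φ g'') (g := LinearMap.id)
    (Representation.IndV.hom_ext _ _ fun h =>
      LinearMap.ext fun v => congrArg (Representation.IndV.mk φ ρ'' h)
        (congrArg Prod.snd (e.apply_symm_apply (0, v)))) x
  have hgf (v : V) : g' (f' v) + g'' (f'' v) = v := by
    refine (map_add e.symm ((e v).1, 0) (0, (e v).2)).symm.trans ?_
    simp
  have hs (x) : indMap φ g' (indMap φ f' x) + indMap φ g'' (indMap φ f'' x) = x :=
    LinearMap.congr_fun
    (f := indMap φ g' ∘ₗ indMap φ f' + indMap φ g'' ∘ₗ indMap φ f'') (g := LinearMap.id)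
    (Representation.IndV.hom_ext _ _ fun h => LinearMap.ext fun v =>
      (map_add (Representation.IndV.mk φ ρ h) _ _).symm.trans
        (congrArg (Representation.IndV.mk φ ρ h) (hgf v))) x
  refine ⟨.mk (LinearEquiv.ofLinearMap ((indMap φ f').prod (indMap φ f''))
      ((indMap φ g').coprod (indMap φ g'')) ?_ ?_) fun h => ?_⟩
  · refine LinearMap.ext fun x => Prod.ext ?_ ?_
    · simp [h11, h12]
    · simp [h21, h22]
  · exact LinearMap.ext fun x => hs x
  · refine Representation.IndV.hom_ext _ _ fun h' => LinearMap.ext fun v => ?_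
    refine Prod.ext ?_ ?_
    · change indMap φ f' (Representation.ind φ ρ h (Representation.IndV.mk φ ρ h' v)) =
        Representation.ind φ ρ' h (Representation.IndV.mk φ ρ' h' (f' v))
      rw [Representation.ind_mk, Representation.ind_mk, indMap_mk]
    · change indMap φ f'' (Representation.ind φ ρ h (Representation.IndV.mk φ ρ h' v)) =
        Representation.ind φ ρ'' h (Representation.IndV.mk φ ρ'' h' (f'' v))
      rw [Representation.ind_mk, Representation.ind_mk, indMap_mk]

/-- Induction of virtual representations along a homomorphism into a finite group. -/
def ind [Finite H] (φ : G →* H) : VRep G →+ VRep H :=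
  lift (fun V => mk (Representation.ind φ V.ρ)) (by
    rintro V V' V'' ⟨e⟩
    exact mk_eq_add (ind_isSum φ e).some)

end VRep
end VirtualRep

/-- Apply an additive map to every coefficient of a polynomial. -/
def mapCoeff {A B : Type*} [Semiring A] [Semiring B] (f : A →+ B) (p : A[X]) : B[X] :=
  p.sum fun i a => Polynomial.monomial i (f a)

@[simp]
theorem coeff_mapCoeff {A B : Type*} [Semiring A] [Semiring B] (f : A →+ B) (p : A[X]) (n : ℕ) :
    (mapCoeff f p).coeff n = f (p.coeff n) := by
  rw [mapCoeff, Polynomial.sum_def, Polynomial.finsetSum_coeff]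
  simp only [Polynomial.coeff_monomial]
  by_cases h : p.coeff n = 0 <;> simp [h]

/-! ## Equivariant Kazhdan-Lusztig, inverse Kazhdan-Lusztig and Z-polynomials -/

section Polynomials

variable {α : Type*}

/-- The rank of a set in a matroid on a finite ground set, as a natural number. -/
def rk (M : Matroid α) (S : Set α) : ℕ := (M.eRk S).toNat

/-- The rank of a matroid on a finite ground set, as a natural number. -/
def rank (M : Matroid α) : ℕ := M.eRank.toNat

/-- `W` acts by symmetries of `M`: its action preserves the ground set and the set of bases. -/
def IsSymmetric (W : Type*) [Group W] [MulAction W α] (M : Matroid α) : Prop :=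
  ∀ w : W, w • M.E = M.E ∧ ∀ B, M.IsBase B → M.IsBase (w • B)

/-- The `W`-orbits of those subsets `S` of the ground type whose chosen representative satisfies
`p`. It is only used for properties `p` that are invariant under the action. -/
abbrev SubsetOrbits (W : Type) [Group W] [MulAction W α] (p : Set α → Prop) : Type _ :=
  {o : MulAction.orbitRel.Quotient W (Set α) // p o.out}

/-- The chosen representative of an orbit of subsets. -/
abbrev SubsetOrbits.rep {W : Type} [Group W] [MulAction W α] {p : Set α → Prop}
    (o : SubsetOrbits W p) : Set α := o.1.out

/-- Induction of polynomials from the stabilizer of `S` to `W`. -/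
def indStab {W : Type} [Group W] [Finite W] [MulAction W α] (S : Set α)
    (f : (VRep (MulAction.stabilizer W S))[X]) : (VRep W)[X] :=
  mapCoeff (VRep.ind (MulAction.stabilizer W S).subtype) f

/-- For a polynomial `R` of degree at most `k`, the unique polynomial `P` with coefficients in
degrees `< k / 2` such that `P + R` is palindromic of degree `k`, that is, such that the
coefficients of `P + R` in degrees `i` and `k - i` agree. -/
def palindromicCorrection {A : Type*} [CommRing A] (k : ℕ) (R : A[X]) : A[X] :=
  ∑ i ∈ Finset.range k with 2 * i < k, Polynomial.monomial i (R.coeff (k - i) - R.coeff i)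

open scoped Classical in
/-- The equivariant Kazhdan-Lusztig polynomial `P`, where `W` acts on `M` by symmetries.
It is `1` (the trivial representation) if the ground set is empty. Otherwise it is the unique
polynomial of degree less than half the rank for which `P + R` is palindromic of degree the rank,
where `R` is the sum over all orbits `[S]` of nonempty subsets `S` of the ground set of
`t ^ rk S * Ind P_{M / S}`, the induction being from the stabilizer of `S` to `W`. -/
def klPoly (W : Type) [Group W] [Finite W] [MulAction W α] (M : Matroid α) [M.Finite] :
    (VRep W)[X] :=
  if M.E = ∅ then 1 else
    palindromicCorrection (rank M) (∑ᶠ o : SubsetOrbits W fun S => S ⊆ M.E ∧ S.Nonempty,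
      Polynomial.X ^ rk M o.rep *
        indStab o.rep (klPoly (MulAction.stabilizer W o.rep) (M.contract o.rep)))
termination_by M.E.ncard
decreasing_by
  refine Set.ncard_lt_ncard ⟨Set.sdiff_subset, fun h => ?_⟩ M.ground_finite
  obtain ⟨x, hx⟩ := o.2.2
  exact (h (o.2.1 hx)).2 hx

/-- The sum `R` over all orbits of nonempty subsets occurring in the definition of `klPoly`. -/
def klRest (W : Type) [Group W] [Finite W] [MulAction W α] (M : Matroid α) [M.Finite] :
    (VRep W)[X] :=
  ∑ᶠ o : SubsetOrbits W fun S => S ⊆ M.E ∧ S.Nonempty,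
    Polynomial.X ^ rk M o.rep *
      indStab o.rep (klPoly (MulAction.stabilizer W o.rep) (M.contract o.rep))

/-- The equivariant `Z`-polynomial: the sum over the orbits `[S]` of all subsets `S` of the ground
set of `t ^ rk S * Ind P_{M / S}`. The summand of `S = ∅` is `P` itself. -/
def zPoly (W : Type) [Group W] [Finite W] [MulAction W α] (M : Matroid α) [M.Finite] :
    (VRep W)[X] :=
  klPoly W M + klRest W M

open scoped Classical in
/-- The equivariant inverse Kazhdan-Lusztig polynomial `Q`. It is `1` if the ground set `E` is
empty. Otherwise it is determined by the vanishing of the sum over the orbits `[S]` of all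
`S ⊆ E` of `(-1) ^ rk S * Ind (Q_{M | S} * P_{M / S})`, in which the summand of `S = E` is
`(-1) ^ rk M * Q`. -/
def invKlPoly (W : Type) [Group W] [Finite W] [MulAction W α] (M : Matroid α) [M.Finite] :
    (VRep W)[X] :=
  if M.E = ∅ then 1 else
    -((-1) ^ rank M * ∑ᶠ o : SubsetOrbits W fun S => S ⊂ M.E,
      (-1) ^ rk M o.rep *
        indStab o.rep (
          haveI := M.restrict_finite (M.ground_finite.subset o.2.subset)
          invKlPoly (MulAction.stabilizer W o.rep) (M.restrict o.rep) *
          klPoly (MulAction.stabilizer W o.rep) (M.contract o.rep)))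
termination_by M.E.ncard
decreasing_by
  exact Set.ncard_lt_ncard o.2 M.ground_finite

/-! The defining properties of the Kazhdan-Lusztig and `Z`-polynomials. -/

theorem klPoly_eq (W : Type) [Group W] [Finite W] [MulAction W α] (M : Matroid α) [M.Finite]
    (hE : M.E ≠ ∅) : klPoly W M = palindromicCorrection (rank M) (klRest W M) := by
  rw [klPoly, if_neg hE, klRest]

theorem klPoly_of_empty (W : Type) [Group W] [Finite W] [MulAction W α] (M : Matroid α)
    [M.Finite] (hE : M.E = ∅) : klPoly W M = 1 := by
  rw [klPoly, if_pos hE]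

theorem coeff_palindromicCorrection {A : Type*} [CommRing A] (k : ℕ) (R : A[X]) (i : ℕ) :
    (palindromicCorrection k R).coeff i =
      if 2 * i < k then R.coeff (k - i) - R.coeff i else 0 := by
  simp only [palindromicCorrection, Polynomial.finsetSum_coeff, Polynomial.coeff_monomial,
    Finset.sum_ite_eq', Finset.mem_filter, Finset.mem_range]
  exact if_congr (by omega) rfl rfl

/-- The degree of `P` is less than half the rank if the ground set is nonempty. -/
theorem klPoly_coeff_eq_zero (W : Type) [Group W] [Finite W] [MulAction W α] (M : Matroid α)
    [M.Finite] (hE : M.E ≠ ∅) {i : ℕ} (hi : rank M ≤ 2 * i) : (klPoly W M).coeff i = 0 := by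
  rw [klPoly_eq W M hE, coeff_palindromicCorrection, if_neg (by omega)]

theorem rank_contract_add (M : Matroid α) [M.Finite] {S : Set α} (hS : S ⊆ M.E) :
    rank (M.contract S) + rk M S = rank M := by
  obtain ⟨I, hI⟩ := M.exists_isBasis S
  obtain ⟨B, hB, hIB⟩ := hI.indep.exists_isBase_superset
  have hBS : B ∩ S = I :=
    (hI.eq_of_subset_indep (hB.indep.subset Set.inter_subset_left)
      (Set.subset_inter hIB hI.subset) Set.inter_subset_right).symm
  have hc : (M.contract S).IsBase (B \ S) := by
    rw [← Matroid.isBasis_ground_iff]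
    exact hB.isBasis_ground.contract_isBasis hI
      (hB.indep.subset (Set.union_subset Set.sdiff_subset hIB))
  have hfin : B.Finite := M.ground_finite.subset hB.subset_ground
  rw [rank, rk, rank, ← hc.encard_eq_eRank, ← hI.encard_eq_eRk, ← hB.encard_eq_eRank, ← hBS]
  have h := Set.ncard_inter_add_ncard_sdiff_eq_ncard B S hfin
  simp only [Set.ncard] at h
  omega

theorem klRest_coeff_eq_zero (W : Type) [Group W] [Finite W] [MulAction W α] (M : Matroid α)
    [M.Finite] {i : ℕ} (hi : rank M < i) : (klRest W M).coeff i = 0 := by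
  refine finsum_induction (fun p : (VRep W)[X] => p.coeff i = 0) (by simp)
    (fun p q hp hq => by simp [hp, hq]) fun o => ?_
  have h : rank (M.contract o.rep) + rk M o.rep = rank M := rank_contract_add M o.2.1
  rw [Polynomial.coeff_X_pow_mul', if_pos (by omega), indStab, coeff_mapCoeff]
  by_cases hE : (M.contract o.rep).E = ∅
  · rw [klPoly_of_empty _ _ hE, Polynomial.coeff_one, if_neg (by omega), map_zero]
  · rw [klPoly_coeff_eq_zero _ _ hE (by omega), map_zero]

/-- The degree of `Z` is at most the rank. -/
theorem zPoly_coeff_eq_zero (W : Type) [Group W] [Finite W] [MulAction W α] (M : Matroid α)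
    [M.Finite] {i : ℕ} (hi : rank M < i) : (zPoly W M).coeff i = 0 := by
  rw [zPoly, Polynomial.coeff_add, klRest_coeff_eq_zero W M hi, add_zero]
  by_cases hE : M.E = ∅
  · rw [klPoly_of_empty _ _ hE, Polynomial.coeff_one, if_neg (by omega)]
  · exact klPoly_coeff_eq_zero _ _ hE (by omega)

/-- `Z` is palindromic. -/
theorem zPoly_palindromic (W : Type) [Group W] [Finite W] [MulAction W α] (M : Matroid α)
    [M.Finite] {i j : ℕ} (hij : i + j = rank M) : (zPoly W M).coeff i = (zPoly W M).coeff j := by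
  rcases eq_or_ne M.E ∅ with hE | hE
  · have : rank M = 0 := by
      have := M.eRank_le_encard_ground
      rw [hE, Set.encard_empty, nonpos_iff_eq_zero] at this
      rw [rank, this]; rfl
    rw [show i = j by omega]
  · rw [zPoly, Polynomial.coeff_add, Polynomial.coeff_add, klPoly_eq W M hE,
      coeff_palindromicCorrection, coeff_palindromicCorrection]
    rcases lt_trichotomy i j with h | h | h
    · rw [if_pos (by omega), if_neg (by omega), ← hij, Nat.add_sub_cancel_left]; ring
    · rw [h]
    · rw [if_neg (by omega), if_pos (by omega), ← hij, Nat.add_sub_cancel]; ring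

end Polynomials

/-! ## Relaxation of stressed hyperplanes -/

section Relaxation

variable {α : Type*}

/-- A hyperplane is a maximal proper flat. -/
def IsHyperplane (M : Matroid α) (H : Set α) : Prop :=
  Maximal (fun F => M.IsFlat F ∧ F ≠ M.E) H

/-- A hyperplane `H` of a matroid of rank `k` is stressed if all `k`-element subsets of `H` are
circuits. -/
def IsStressedHyperplane (M : Matroid α) (H : Set α) : Prop :=
  IsHyperplane M H ∧ ∀ C ⊆ H, C.encard = M.eRank → M.IsCircuit C

theorem IsSymmetric.isBase_iff {W : Type*} [Group W] [MulAction W α] {M : Matroid α}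
    (h : IsSymmetric W M) (w : W) (B : Set α) : M.IsBase (w • B) ↔ M.IsBase B :=
  ⟨fun hB => by simpa using (h w⁻¹).2 _ hB, (h w).2 B⟩

theorem IsSymmetric.indep_iff {W : Type*} [Group W] [MulAction W α] {M : Matroid α}
    (h : IsSymmetric W M) (w : W) (I : Set α) : M.Indep (w • I) ↔ M.Indep I := by
  have key : ∀ (w : W) (I : Set α), M.Indep I → M.Indep (w • I) := fun w I hI => by
    obtain ⟨B, hB, hIB⟩ := hI.exists_isBase_superset
    exact ((h w).2 B hB).indep.subset (Set.smul_set_mono hIB)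
  exact ⟨fun hI => by simpa using key w⁻¹ _ hI, key w I⟩

theorem IsSymmetric.mapEquiv_eq {W : Type*} [Group W] [MulAction W α] {M : Matroid α}
    (h : IsSymmetric W M) (w : W) : M.mapEquiv (MulAction.toPerm w) = M := by
  refine Matroid.ext_indep (h w).1 fun I _ => ?_
  rw [Matroid.mapEquiv_indep_iff]
  exact h.indep_iff w⁻¹ I

theorem IsSymmetric.isFlat_smul {W : Type*} [Group W] [MulAction W α] {M : Matroid α}
    (h : IsSymmetric W M) (w : W) {F : Set α} (hF : M.IsFlat F) : M.IsFlat (w • F) := by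
  have hb : ∀ I X : Set α, M.IsBasis I X → M.IsBasis (w⁻¹ • I) (w⁻¹ • X) := fun I X hI => by
    rw [← h.mapEquiv_eq w, Matroid.mapEquiv_isBasis_iff] at hI
    exact hI
  refine ⟨fun I X hI hX => ?_, ?_⟩
  · have := hF.subset_of_isBasis_of_isBasis (by simpa using hb _ _ hI) (hb _ _ hX)
    rwa [Set.subset_smul_set_iff]
  · rw [← (h w).1]
    exact Set.smul_set_mono hF.subset_ground

theorem IsSymmetric.isStressedHyperplane_smul {W : Type*} [Group W] [MulAction W α]
    {M : Matroid α} (h : IsSymmetric W M) (w : W) {H : Set α} (hH : IsStressedHyperplane M H) :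
    IsStressedHyperplane M (w • H) := by
  have hne : ∀ F : Set α, F ≠ M.E → w⁻¹ • F ≠ M.E := fun F hF h' => hF (by
    rw [← (h w).1, ← h', smul_inv_smul])
  refine ⟨⟨⟨h.isFlat_smul w hH.1.prop.1, fun h' => hH.1.prop.2 ?_⟩, fun F hF hHF => ?_⟩,
    fun C hC hcard => ?_⟩
  · rw [← inv_smul_smul w H, h', (h w⁻¹).1]
  · exact Set.subset_smul_set_iff.2 (hH.1.le_of_ge ⟨h.isFlat_smul w⁻¹ hF.1, hne F hF.2⟩
      (by simpa using Set.smul_set_mono (a := w⁻¹) hHF))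
  · have hC' : w⁻¹ • C ⊆ H := by simpa using Set.smul_set_mono (a := w⁻¹) hC
    have hCE : C ⊆ M.E := hC.trans (h.isFlat_smul w hH.1.prop.1).subset_ground
    have hcirc := hH.2 _ hC' (((MulAction.injective w⁻¹).encard_image C).trans hcard)
    rw [Matroid.isCircuit_iff_minimal_not_indep hcirc.subset_ground] at hcirc
    rw [Matroid.isCircuit_iff_minimal_not_indep hCE]
    refine ⟨fun hi => hcirc.prop ((h.indep_iff w⁻¹ C).2 hi), fun D hD hDC => ?_⟩
    exact Set.smul_set_subset_smul_set_iff.1 (hcirc.le_of_le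
      (fun hi => hD ((h.indep_iff w⁻¹ D).1 hi)) (Set.smul_set_mono hDC))

/-- All members of the orbit of a stressed hyperplane are stressed hyperplanes. -/
theorem IsSymmetric.isStressedHyperplane_of_mem_orbit {W : Type*} [Group W] [MulAction W α]
    {M : Matroid α} (h : IsSymmetric W M) {H : Set α} (hH : IsStressedHyperplane M H) :
    ∀ J ∈ MulAction.orbit W H, IsStressedHyperplane M J := by
  rintro _ ⟨w, rfl⟩
  exact h.isStressedHyperplane_smul w hH

theorem IsHyperplane.subset_closure {M : Matroid α} [M.Finite] {H I : Set α}
    (hH : IsHyperplane M H) (hIH : I ⊆ H) (hI : M.Indep I) (hc : I.encard + 1 = M.eRank) :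
    H ⊆ M.closure I := by
  intro e he
  by_contra hcl
  have heE : e ∈ M.E := hH.prop.1.subset_ground he
  have hins : M.Indep (insert e I) := by
    rw [Matroid.insert_indep_iff]
    exact ⟨hI, fun _ => ⟨heE, hcl⟩⟩
  have heI : e ∉ I := fun h => hcl (M.mem_closure_of_mem h hI.subset_ground)
  have hB : M.IsBase (insert e I) := hins.isBase_of_eRk_ge
    (M.ground_finite.subset hins.subset_ground) (by
      rw [hins.eRk_eq_encard, Set.encard_insert_of_notMem heI, hc])
  refine hH.prop.2 (hH.prop.1.subset_ground.antisymm ?_)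
  rw [← hB.closure_eq, ← hH.prop.1.closure]
  exact M.closure_subset_closure (Set.insert_subset he hIH)

theorem relax_exchange (M : Matroid α) [M.Finite] (F : Set (Set α))
    (hF : ∀ H ∈ F, IsStressedHyperplane M H) :
    Matroid.ExchangeProperty fun B => M.IsBase B ∨ ∃ H ∈ F, B ⊆ H ∧ B.encard = M.eRank := by
  have hcard : ∀ B, (M.IsBase B ∨ ∃ H ∈ F, B ⊆ H ∧ B.encard = M.eRank) → B.encard = M.eRank := by
    rintro B (hB | ⟨-, -, -, hB⟩)
    exacts [hB.encard_eq_eRank, hB]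
  have hind : ∀ B, (M.IsBase B ∨ ∃ H ∈ F, B ⊆ H ∧ B.encard = M.eRank) → ∀ x ∈ B,
      M.Indep (B \ {x}) := by
    rintro B (hB | ⟨H, hH, hBH, hB⟩) x hx
    · exact hB.indep.subset Set.sdiff_subset
    · exact ((hF H hH).2 B hBH hB).sdiff_singleton_indep hx
  intro B₁ B₂ hB₁ hB₂ x hx
  have hI := hind B₁ hB₁ x hx.1
  have hIc : (B₁ \ {x}).encard + 1 = M.eRank := by
    rw [Set.encard_sdiff_singleton_add_one hx.1, hcard B₁ hB₁]
  have hntop : M.eRank ≠ ⊤ := by rw [Matroid.eRank_ne_top_iff]; infer_instance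
  have hnE : M.closure (B₁ \ {x}) ≠ M.E := fun h => by
    have hb : M.IsBase (B₁ \ {x}) := Matroid.isBase_iff_indep_closure_eq.2 ⟨hI, h⟩
    rw [← hb.encard_eq_eRank] at hIc hntop
    exact absurd hIc (by simpa using (ENat.add_one_le_iff hntop).1 (le_refl _) |>.ne')
  by_cases hsub : B₂ ⊆ M.closure (B₁ \ {x})
  · rcases hB₂ with hb | ⟨J, hJ, hBJ, hc⟩
    · refine absurd ((M.closure_subset_ground _).antisymm ?_) hnE
      rw [← hb.closure_eq]
      exact M.closure_subset_closure_of_subset_closure hsub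
    · have hJI : J ⊆ M.closure (B₁ \ {x}) := by
        have hne : B₂.Nonempty := by
          rw [← Set.encard_ne_zero, hc, ← hIc]
          simp
        obtain ⟨z, hz⟩ := hne
        refine ((hF J hJ).1.subset_closure (Set.sdiff_subset.trans hBJ)
          (((hF J hJ).2 B₂ hBJ hc).sdiff_singleton_indep hz) ?_).trans
          (M.closure_subset_closure_of_subset_closure (Set.sdiff_subset.trans hsub))
        rw [Set.encard_sdiff_singleton_add_one hz, hc]
      have hIJ : B₁ \ {x} ⊆ J := (M.subset_closure _ hI.subset_ground).trans
        ((hF J hJ).1.le_of_ge ⟨M.isFlat_closure _, hnE⟩ hJI)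
      have hy : ∃ y, y ∈ B₂ \ B₁ := by
        by_contra! hcon
        have h21 : B₂ ⊆ B₁ := fun y hy => by_contra fun h => hcon y ⟨hy, h⟩
        have hfin : B₁.Finite := by
          rw [← Set.encard_ne_top_iff, hcard B₁ hB₁]; exact hntop
        have := hfin.eq_of_subset_of_encard_le' h21 (by rw [hcard B₁ hB₁, hc])
        exact hx.2 (this ▸ hx.1)
      obtain ⟨y, hy⟩ := hy
      refine ⟨y, hy, Or.inr ⟨J, hJ, Set.insert_subset (hBJ hy.1) hIJ, ?_⟩⟩
      rw [Set.encard_insert_of_notMem fun h => hy.2 h.1, hIc]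
  · obtain ⟨y, hy, hycl⟩ := Set.not_subset.1 hsub
    have hyI : y ∉ B₁ \ {x} := fun h => hycl (M.mem_closure_of_mem h hI.subset_ground)
    have hyE : y ∈ M.E := by
      rcases hB₂ with hb | ⟨J, hJ, hBJ, -⟩
      · exact hb.subset_ground hy
      · exact (hF J hJ).1.prop.1.subset_ground (hBJ hy)
    have hins : M.Indep (insert y (B₁ \ {x})) := by
      rw [Matroid.insert_indep_iff]
      exact ⟨hI, fun _ => ⟨hyE, hycl⟩⟩
    refine ⟨y, ⟨hy, fun h => hyI ⟨h, fun h' => hx.2 ?_⟩⟩, Or.inl ?_⟩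
    · rw [Set.mem_singleton_iff] at h'
      exact h' ▸ hy
    · refine hins.isBase_of_eRk_ge (M.ground_finite.subset hins.subset_ground) ?_
      rw [hins.eRk_eq_encard, Set.encard_insert_of_notMem hyI, hIc]

/-- The relaxation of a matroid at a family of stressed hyperplanes: the bases are those of `M`
together with all `k`-element subsets of members of the family, where `k` is the rank. -/
def relax (M : Matroid α) [M.Finite] (F : Set (Set α))
    (hF : ∀ H ∈ F, IsStressedHyperplane M H) : Matroid α :=
  Matroid.ofIsBaseOfFinite M.ground_finite
    (fun B => M.IsBase B ∨ ∃ H ∈ F, B ⊆ H ∧ B.encard = M.eRank)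
    (M.exists_isBase.imp fun _ => Or.inl) (relax_exchange M F hF) (by
      rintro B (hB | ⟨H, hH, hB, -⟩)
      · exact hB.subset_ground
      · exact hB.trans (hF H hH).1.prop.1.subset_ground)

instance (M : Matroid α) [M.Finite] (F : Set (Set α))
    (hF : ∀ H ∈ F, IsStressedHyperplane M H) : (relax M F hF).Finite :=
  ⟨M.ground_finite⟩

/-- The homomorphism from the stabilizer of `H` to the symmetric group on `h` letters given by the
action on `H` and an ordering `e` of `H`. -/
def stabToPerm {W : Type} [Group W] [MulAction W α] (H : Set α) {h : ℕ} (e : H ≃ Fin h) :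
    MulAction.stabilizer W H →* Equiv.Perm (Fin h) :=
  e.permCongrHom.toMonoidHom.comp (MulAction.toPermHom (MulAction.stabilizer W H) H)

/-- The representation `Ind Res f` of `W`, coefficient by coefficient: pull `f` back to the
stabilizer of `H` and induce it to `W`. -/
def indRes {W : Type} [Group W] [Finite W] [MulAction W α] (H : Set α) {h : ℕ} (e : H ≃ Fin h)
    (f : (VRep (Equiv.Perm (Fin h)))[X]) : (VRep W)[X] :=
  indStab H (mapCoeff (VRep.res (stabToPerm H e)) f)

end Relaxation

end EquivariantKL

end

/-! ## Characters of virtual representations -/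

namespace EquivariantKL.VRep

section Character

variable {G : Type} [Group G]

/-! A virtual rational representation of a finite group is determined by its character, so each of
the three identities can be checked at one element `w` of `W` at a time. The character of a sum over
orbits of representations induced from stabilizers is a sum over the sets fixed by `w`. Hence the
character values of `P`, `Z` and `Q` at `w` satisfy ordinary recursions over `w`-fixed subsets
(`numKL`, `numZ`, `numInv`). These involve only the matroid and the permutation `w`, and no longer
the group.

In these recursions the relaxation is local. Let `g` be the permutation and `S` a fixed set. If `S`
lies in no relaxed hyperplane, its rank and contraction are unchanged. If `S` lies in a relaxed
hyperplane `H` and has fewer than `k` elements, it is independent before and after, and the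
contraction of the relaxation by `S` is again a relaxation, of rank `k - |S|`, at the hyperplanes
`H' \ S` with `S ⊆ H'`. If `S ⊆ H` has at least `k` elements, its contraction has rank zero after
relaxation and contributes nothing. Before relaxation the contraction has rank one with loops `H \
S`, so it contributes only for `S = H`. By induction on the rank, the change is a sum over the fixed
relaxed hyperplanes `H` of a term `relKL`, `relKL + relRest` or `relInv`. This term depends only on
`k` and on the action of `g` on `H`; for `Q` it also uses the restriction to `H`, which is always
the uniform matroid of rank `k - 1`.

The character of `Ind Res f` at `w` is likewise a sum over the `w`-fixed members of the orbit of
`H`. It remains to find virtual representations of the symmetric group whose characters are these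
local terms. They are the changes of `P`, `Q` and `Z` in one example: a coloop plus the uniform
matroid of rank `k - 1` on `h` elements, whose stressed hyperplane of non-coloops is preserved by
the whole symmetric group. -/

theorem character_isSum (g : G) (V V' V'' : FDRep ℚ G) (h : IsSum V V' V'') :
    Representation.character V.ρ g =
      Representation.character V'.ρ g + Representation.character V''.ρ g := by
  obtain ⟨e⟩ := h
  rw [Representation.char_iso e]
  exact LinearMap.trace_prodMap' _ _

/-- The value of the character of a virtual representation at a group element. -/
noncomputable def charHom (g : G) : VRep G →+* ℚ where
  toFun := lift (fun V => Representation.character V.ρ g) (character_isSum g)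
  map_zero' := map_zero _
  map_add' := map_add _
  map_one' := by
    rw [one_def, mk, lift_of]
    change LinearMap.trace ℚ ℚ (Representation.trivial ℚ G ℚ g) = 1
    rw [show Representation.trivial ℚ G ℚ g = 1 from rfl, LinearMap.trace_one]
    simp
  map_mul' x y := by
    induction x using induction_on with
    | zero => simp
    | add x x' hx hx' => rw [add_mul, map_add, hx, hx', map_add, add_mul]
    | neg x hx => rw [neg_mul, map_neg, hx, map_neg, neg_mul]
    | of U =>
    induction y using induction_on with
    | zero => simp
    | add x x' hx hx' => rw [mul_add, map_add, hx, hx', map_add, mul_add]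
    | neg x hx => rw [mul_neg, map_neg, hx, map_neg, mul_neg]
    | of V =>
    rw [of_mul_of, mk, lift_of, lift_of, lift_of]
    exact congrFun (Representation.char_tensor U.ρ V.ρ) g

variable {V V' V'' : Type} [AddCommGroup V] [Module ℚ V] [Module.Finite ℚ V]
    [AddCommGroup V'] [Module ℚ V'] [Module.Finite ℚ V']
    [AddCommGroup V''] [Module ℚ V''] [Module.Finite ℚ V'']
    {ρ : Representation ℚ G V} {ρ' : Representation ℚ G V'} {ρ'' : Representation ℚ G V''}

@[simp]
theorem charHom_of (g : G) (V : FDRep ℚ G) : charHom g (of V) = Representation.character V.ρ g :=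
  lift_of _ (character_isSum g) V

@[simp]
theorem charHom_mk (g : G) (ρ : Representation ℚ G V) : charHom g (mk ρ) = ρ.character g :=
  lift_of _ (character_isSum g) _

/-- Direct sums gather the positive and the negative terms into one representation each. Comparing
virtual representations thus reduces to comparing two genuine ones. -/
theorem exists_eq_mk_sub_mk (x : VRep G) : ∃ (V V' : FDRep ℚ G), x = of V - of V' := by
  induction x using induction_on with
  | zero => exact ⟨FDRep.of (Representation.trivial ℚ G ℚ), FDRep.of (Representation.trivial ℚ G ℚ),
      (sub_self _).symm⟩
  | of V =>
    have h0 : mk (Representation.trivial ℚ G PUnit.{1}) = 0 := by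
      have := mk_eq_add (ρ := Representation.trivial ℚ G PUnit.{1})
        (ρ' := Representation.trivial ℚ G PUnit.{1}) (ρ'' := Representation.trivial ℚ G PUnit.{1})
        (.mk (LinearEquiv.ofSubsingleton _ _) fun g => by ext)
      simpa using this
    exact ⟨V, FDRep.of (Representation.trivial ℚ G PUnit.{1}), by
      rw [show of (FDRep.of (Representation.trivial ℚ G PUnit.{1})) = 0 from h0, sub_zero]⟩
  | neg x hx =>
    obtain ⟨V, V', rfl⟩ := hx
    exact ⟨V', V, neg_sub _ _⟩
  | add x y hx hy =>
    obtain ⟨V, V', rfl⟩ := hx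
    obtain ⟨U, U', rfl⟩ := hy
    refine ⟨FDRep.of (Representation.prod V.ρ U.ρ), FDRep.of (Representation.prod V'.ρ U'.ρ), ?_⟩
    have h1 : of (FDRep.of (Representation.prod V.ρ U.ρ)) = of V + of U :=
      mk_eq_add (V' := V) (V'' := U) (ρ' := V.ρ) (ρ'' := U.ρ)
        (.refl (Representation.prod V.ρ U.ρ))
    have h2 : of (FDRep.of (Representation.prod V'.ρ U'.ρ)) = of V' + of U' :=
      mk_eq_add (V' := V') (V'' := U') (ρ' := V'.ρ) (ρ'' := U'.ρ)
        (.refl (Representation.prod V'.ρ U'.ρ))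
    rw [h1, h2]
    abel

variable [Finite G]

/-- Classes are additive on short exact sequences. -/
theorem mk_eq_add_of_exact (i : ρ'.IntertwiningMap ρ) (p : ρ.IntertwiningMap ρ'')
    (hi : Function.Injective i) (hp : Function.Surjective p) (h : Function.Exact i p) :
    mk ρ = mk ρ' + mk ρ'' := by
  have := Fintype.ofFinite G
  obtain ⟨r₀, hr₀⟩ := i.toLinearMap.exists_leftInverse_of_injective (LinearMap.ker_eq_bot.2 hi)
  have hr₀' (v : V') : r₀ (i v) = v := LinearMap.congr_fun hr₀ v
  have hi' (g : G) (v : V') : i (ρ' g v) = ρ g (i v) := Representation.IntertwiningMap.isIntertwining _ _ i g v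
  have hcard : (Fintype.card G : ℚ) ≠ 0 := Nat.cast_ne_zero.2 Fintype.card_ne_zero
  -- Maschke's argument: averaging the linear retraction `r₀` over the group makes it equivariant,
  -- and it remains a retraction of `i`.
  let r : V →ₗ[ℚ] V' := (Fintype.card G : ℚ)⁻¹ • ∑ g : G, ρ' g⁻¹ ∘ₗ r₀ ∘ₗ ρ g
  have hr (v : V) : r v = (Fintype.card G : ℚ)⁻¹ • ∑ g : G, ρ' g⁻¹ (r₀ (ρ g v)) := by
    simp [r]
  have hrg (g : G) (v : V) : r (ρ g v) = ρ' g (r v) := by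
    rw [hr, hr, map_smul, map_sum]
    congr 1
    refine Fintype.sum_bijective (· * g) (Group.mulRight_bijective g) _ _ fun x => ?_
    simp only [mul_inv_rev, map_mul, Module.End.mul_apply]
    rw [← Module.End.mul_apply (ρ' g), ← map_mul, mul_inv_cancel, map_one, Module.End.one_apply]
  have hri (v : V') : r (i v) = v := by
    rw [hr, Finset.sum_congr rfl fun g _ => show ρ' g⁻¹ (r₀ (ρ g (i v))) = v by
      rw [← hi', hr₀', ← Module.End.mul_apply, ← map_mul, inv_mul_cancel, map_one,
        Module.End.one_apply]]
    rw [Finset.sum_const, Finset.card_univ, ← Nat.cast_smul_eq_nsmul ℚ, smul_smul,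
      inv_mul_cancel₀ hcard, one_smul]
  have hpi (v : V') : p (i v) = 0 := (h _).2 ⟨v, rfl⟩
  have hb : Function.Bijective (r.prod p.toLinearMap) := by
    constructor
    · rw [injective_iff_map_eq_zero]
      intro v hv
      obtain ⟨w, rfl⟩ := (h v).1 (congrArg Prod.snd hv)
      have : r (i w) = 0 := congrArg Prod.fst hv
      rw [hri] at this
      rw [this, map_zero]
    · rintro ⟨a, b⟩
      obtain ⟨v, rfl⟩ := hp b
      refine ⟨v + i (a - r v), Prod.ext ?_ ?_⟩
      · change r (v + i (a - r v)) = a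
        rw [map_add, hri, add_sub_cancel]
      · change p (v + i (a - r v)) = p v
        rw [map_add, hpi, add_zero]
  refine mk_eq_add (.mk (LinearEquiv.ofBijective _ hb) fun g => LinearMap.ext fun v => ?_)
  exact Prod.ext (hrg g v) (Representation.IntertwiningMap.isIntertwining _ _ p g v)

/-- Two representations with the same character have the same class. -/
theorem mk_eq_mk_of_character_eq {V V' : Type} [AddCommGroup V] [Module ℚ V] [Module.Finite ℚ V]
    [AddCommGroup V'] [Module ℚ V'] [Module.Finite ℚ V']
    (ρ : Representation ℚ G V) (ρ' : Representation ℚ G V')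
    (hχ : ρ.character = ρ'.character) : mk ρ = mk ρ' := by
  have := Fintype.ofFinite G
  have hcard : (Nat.card G : ℚ) ≠ 0 := Nat.cast_ne_zero.2 Nat.card_pos.ne'
  let := invertibleOfNonzero hcard
  -- Induction on the dimension. The image of a nonzero intertwining map is a common summand of both
  -- sides; the kernel and the cokernel that remain have equal characters and smaller dimension. No
  -- decomposition into irreducibles is needed.
  induction hn : Module.finrank ℚ V using Nat.strong_induction_on generalizing V V' with
  | _ n ih =>
  have hdim : Module.finrank ℚ V = Module.finrank ℚ V' := by
    have := congrFun hχ 1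
    rw [Representation.char_one, Representation.char_one] at this
    exact_mod_cast this
  rcases Nat.eq_zero_or_pos (Module.finrank ℚ V) with h0 | hpos
  · have h0' := hdim ▸ h0
    rw [Module.finrank_zero_iff] at h0 h0'
    exact mk_congr (.mk (LinearEquiv.ofSubsingleton _ _) fun g => LinearMap.ext fun v =>
      Subsingleton.elim _ _)
  -- Dimensions of spaces of intertwining maps are computed by characters, so this space is as large
  -- as the endomorphisms of `ρ`, among which is the nonzero identity.
  have hfin : (Module.finrank ℚ (ρ.IntertwiningMap ρ') : ℚ) =
      Module.finrank ℚ (ρ.IntertwiningMap ρ) := by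
    rw [← Representation.card_inv_mul_sum_char_mul_char_eq_finrank,
      ← Representation.card_inv_mul_sum_char_mul_char_eq_finrank, hχ]
  have hnt : Nontrivial V := Module.nontrivial_of_finrank_pos hpos
  obtain ⟨v, hv⟩ := exists_ne (0 : V)
  have hex : ∃ f : ρ.IntertwiningMap ρ', f ≠ 0 := by
    by_contra! hcon
    have : Subsingleton (ρ.IntertwiningMap ρ') := ⟨fun a b => (hcon a).trans (hcon b).symm⟩
    rw [Module.finrank_zero_of_subsingleton, Nat.cast_zero, eq_comm, Nat.cast_eq_zero] at hfin
    have hinj : Function.Injective (fun f : ρ.IntertwiningMap ρ => f.toLinearMap) :=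
      Representation.IntertwiningMap.toLinearMap_injective _ _
    have : Module.Finite ℚ (ρ.IntertwiningMap ρ) :=
      Module.Finite.of_injective (Representation.IntertwiningMap.toLinearMapl (ρ := ρ) (σ := ρ)) hinj
    rw [Module.finrank_zero_iff] at hfin
    have h1 : Representation.IntertwiningMap.id ρ = 0 := Subsingleton.elim _ _
    exact hv (DFunLike.congr_fun h1 v)
  obtain ⟨f, hf⟩ := hex
  let K := f.ker
  let I := f.range
  have hI : ∀ g, I.toSubmodule ≤ I.toSubmodule.comap (ρ' g) := fun g _ hx =>
    I.apply_mem_toSubmodule g hx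
  have h1 : mk ρ = mk K.toRepresentation + mk I.toRepresentation :=
    mk_eq_add_of_exact ⟨K.toSubmodule.subtype, fun g => rfl⟩
      ⟨f.toLinearMap.rangeRestrict, fun g => LinearMap.ext fun v =>
        Subtype.ext (Representation.IntertwiningMap.isIntertwining _ _ f g v)⟩
      Subtype.val_injective f.toLinearMap.surjective_rangeRestrict (fun v => by
        change f.toLinearMap.rangeRestrict v = 0 ↔ v ∈ Set.range K.toSubmodule.subtype
        rw [← LinearMap.mem_ker, LinearMap.ker_rangeRestrict]
        exact ⟨fun h => ⟨⟨v, h⟩, rfl⟩, by rintro ⟨w, rfl⟩; exact w.2⟩)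
  have h2 : mk ρ' = mk I.toRepresentation + mk (ρ'.quotient I.toSubmodule hI) :=
    mk_eq_add_of_exact ⟨I.toSubmodule.subtype, fun g => rfl⟩
      ⟨I.toSubmodule.mkQ, fun g => rfl⟩
      Subtype.val_injective I.toSubmodule.mkQ_surjective (fun v => by
        change I.toSubmodule.mkQ v = 0 ↔ v ∈ Set.range I.toSubmodule.subtype
        rw [Submodule.mkQ_apply, Submodule.Quotient.mk_eq_zero]
        exact ⟨fun h => ⟨⟨v, h⟩, rfl⟩, by rintro ⟨w, rfl⟩; exact w.2⟩)
  have hlt : Module.finrank ℚ K.toSubmodule < Module.finrank ℚ V := by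
    refine Submodule.finrank_lt fun htop => hf ?_
    refine Representation.IntertwiningMap.toLinearMap_injective _ _ (LinearMap.ext fun v => ?_)
    have : v ∈ K.toSubmodule := htop ▸ Submodule.mem_top
    exact this
  rw [h1, h2, ih _ (hn ▸ hlt) K.toRepresentation (ρ'.quotient I.toSubmodule hI) ?_ rfl, add_comm]
  ext g
  have e1 := congrArg (charHom g) h1
  have e2 := congrArg (charHom g) h2
  have e3 := congrFun hχ g
  simp only [map_add, charHom_mk] at e1 e2
  linarith

/-- A virtual representation of a finite group is determined by its character. -/
theorem ext_charHom {x y : VRep G} (h : ∀ g, charHom g x = charHom g y) : x = y := by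
  rw [← sub_eq_zero]
  obtain ⟨V, V', hV⟩ := exists_eq_mk_sub_mk (x - y)
  rw [hV, sub_eq_zero]
  refine mk_eq_mk_of_character_eq (V := V) (V' := V') V.ρ V'.ρ (funext fun g => ?_)
  have : charHom g (x - y) = 0 := by rw [map_sub, h, sub_self]
  rw [hV, map_sub, charHom_of, charHom_of, sub_eq_zero] at this
  exact this

end Character

end EquivariantKL.VRep

namespace EquivariantKL.VRep

/-! ### Characters of induced and restricted representations -/

section InducedCharacter

/-- The trace of an endomorphism of the coinvariants of a finite group. -/
theorem trace_coinvariants_map {G U : Type} [Group G] [Fintype G] [AddCommGroup U] [Module ℚ U]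
    [Module.Finite ℚ U] (T : Representation ℚ G U) (A : T.IntertwiningMap T) :
    LinearMap.trace ℚ _ (Representation.Coinvariants.map T T A) =
      (Fintype.card G : ℚ)⁻¹ * ∑ g : G, LinearMap.trace ℚ U (A.toLinearMap ∘ₗ T g) := by
  have hcard : (Fintype.card G : ℚ) ≠ 0 := Nat.cast_ne_zero.2 Fintype.card_ne_zero
  -- The averaging projector descends to a section `s` of the quotient map. Cyclicity of the trace
  -- then moves the computation from the coinvariants to `U`.
  let e : U →ₗ[ℚ] U := (Fintype.card G : ℚ)⁻¹ • ∑ g : G, T g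
  have he (x : U) : e x = (Fintype.card G : ℚ)⁻¹ • ∑ g : G, T g x := by simp [e]
  let s : T.Coinvariants →ₗ[ℚ] U := Representation.Coinvariants.lift T e fun g =>
    LinearMap.ext fun x => by
      rw [LinearMap.comp_apply, he, he]
      congr 1
      refine Fintype.sum_bijective (· * g) (Group.mulRight_bijective g) _ _ fun y => ?_
      rw [map_mul, Module.End.mul_apply]
  have hs : Representation.Coinvariants.mk T ∘ₗ s = LinearMap.id := by
    refine Representation.Coinvariants.hom_ext (LinearMap.ext fun x => ?_)
    change Representation.Coinvariants.mk T (e x) = Representation.Coinvariants.mk T x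
    rw [he, map_smul, map_sum]
    simp only [Representation.Coinvariants.mk_self_apply, Finset.sum_const, Finset.card_univ]
    rw [← Nat.cast_smul_eq_nsmul ℚ, smul_smul, inv_mul_cancel₀ hcard, one_smul]
  have h1 : Representation.Coinvariants.map T T A =
      Representation.Coinvariants.mk T ∘ₗ (A.toLinearMap ∘ₗ s) := by
    rw [← LinearMap.comp_assoc]
    change _ = (Representation.Coinvariants.map T T A ∘ₗ Representation.Coinvariants.mk T) ∘ₗ s
    rw [LinearMap.comp_assoc, hs, LinearMap.comp_id]
  rw [h1, LinearMap.trace_comp_comm', LinearMap.comp_assoc]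
  change LinearMap.trace ℚ U (A.toLinearMap ∘ₗ e) = _
  have h2 : A.toLinearMap ∘ₗ e = (Fintype.card G : ℚ)⁻¹ • ∑ g : G, A.toLinearMap ∘ₗ T g := by
    refine LinearMap.ext fun x => ?_
    rw [LinearMap.comp_apply, he, map_smul, map_sum]
    simp
  rw [h2, map_smul, smul_eq_mul, map_sum]

/-- The trace of the endomorphism of a group algebra induced by a self-map of the group. -/
theorem trace_mapDomainLinearMap {H : Type} [Group H] [Fintype H] [DecidableEq H] (f : H → H) :
    LinearMap.trace ℚ _ (MonoidAlgebra.mapDomainLinearMap ℚ ℚ f) =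
      ∑ y : H, if f y = y then (1 : ℚ) else 0 := by
  rw [LinearMap.trace_eq_matrix_trace ℚ (MonoidAlgebra.basis H ℚ), Matrix.trace]
  refine Finset.sum_congr rfl fun y _ => ?_
  rw [Matrix.diag_apply, LinearMap.toMatrix_apply, MonoidAlgebra.basis_apply]
  change (MonoidAlgebra.mapDomainLinearMap ℚ ℚ f (MonoidAlgebra.single y 1)).coeff y = _
  rw [MonoidAlgebra.coeff_mapDomainLinearMap, MonoidAlgebra.coeff_single, Finsupp.mapDomain_single,
    Finsupp.single_apply]

/-- The character of an induced representation. -/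
theorem charHom_ind {G H : Type} [Group G] [Group H] [Fintype G] [Fintype H] [DecidableEq H]
    (φ : G →* H) (x : VRep G) (h : H) :
    charHom h (ind φ x) = (Fintype.card G : ℚ)⁻¹ * ∑ g : G, ∑ y : H,
      if φ g * y * h⁻¹ = y then charHom g x else 0 := by
  induction x using induction_on with
  | zero => simp
  | neg x hx =>
    rw [map_neg, map_neg, hx, ← mul_neg, ← Finset.sum_neg_distrib]
    refine congrArg _ (Finset.sum_congr rfl fun g _ => ?_)
    rw [← Finset.sum_neg_distrib]
    refine Finset.sum_congr rfl fun z _ => ?_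
    split_ifs <;> simp
  | add x y hx hy =>
    rw [map_add, map_add, hx, hy, ← mul_add, ← Finset.sum_add_distrib]
    refine congrArg _ (Finset.sum_congr rfl fun g _ => ?_)
    rw [← Finset.sum_add_distrib]
    refine Finset.sum_congr rfl fun z _ => ?_
    split_ifs <;> simp
  | of V =>
    have h1 : ind φ (of V) = mk (Representation.ind φ V.ρ) := lift_of _ _ V
    rw [h1, charHom_mk]
    change LinearMap.trace ℚ _ (Representation.Coinvariants.map _ _ _) = _
    rw [trace_coinvariants_map]
    congr 1
    refine Finset.sum_congr rfl fun g _ => ?_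
    -- Here `h` acts by right multiplication with `h⁻¹` on the group algebra, and `g` acts
    -- diagonally. The composite is a pure tensor of maps, so its trace is the number of `y` with `φ
    -- g * y * h⁻¹ = y` times the character of `V` at `g`.
    have h2 : (MonoidAlgebra.mapDomainLinearMap ℚ ℚ fun x => x * h⁻¹).rTensor V ∘ₗ
        (Representation.tprod ((Representation.leftRegular ℚ H).comp φ) V.ρ) g =
        TensorProduct.map (MonoidAlgebra.mapDomainLinearMap ℚ ℚ fun x => φ g * x * h⁻¹)
          (V.ρ g) := by
      refine TensorProduct.ext (MonoidAlgebra.lhom_ext' fun y => LinearMap.ext_ring ?_)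
      refine LinearMap.ext fun v => ?_
      simp
    change LinearMap.trace ℚ _ ((MonoidAlgebra.mapDomainLinearMap ℚ ℚ fun x => x * h⁻¹).rTensor V ∘ₗ
        (Representation.tprod ((Representation.leftRegular ℚ H).comp φ) V.ρ) g) = _
    rw [h2, LinearMap.trace_tensorProduct', trace_mapDomainLinearMap, Finset.sum_mul]
    refine Finset.sum_congr rfl fun y _ => ?_
    rw [charHom_of, Representation.character]
    split_ifs <;> simp

theorem charHom_res {G H : Type} [Group G] [Group H] (φ : G →* H) (x : VRep H) (g : G) :
    charHom g (res φ x) = charHom (φ g) x := by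
  induction x using induction_on with
  | zero => simp
  | neg x hx => simp [hx]
  | add x y hx hy => simp [hx, hy]
  | of V =>
    have h1 : res φ (of V) = mk (V := V) (V.ρ.comp φ) := lift_of _ _ V
    rw [h1, charHom_mk, charHom_of]
    rfl

end InducedCharacter

end EquivariantKL.VRep

namespace EquivariantKL

open VRep

/-! ### From sums over orbits to sums over fixed sets -/

section CharacterPolynomial

/-- The polynomial of character values at a group element. -/
noncomputable def charPoly {G : Type} [Group G] (g : G) : (VRep G)[X] →+* ℚ[X] :=
  Polynomial.mapRingHom (charHom g)

@[simp]
theorem coeff_charPoly {G : Type} [Group G] (g : G) (f : (VRep G)[X]) (n : ℕ) :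
    (charPoly g f).coeff n = charHom g (f.coeff n) := by
  simp [charPoly]

theorem ext_charPoly {G : Type} [Group G] [Finite G] {f f' : (VRep G)[X]}
    (h : ∀ g, charPoly g f = charPoly g f') : f = f' := by
  ext n
  refine ext_charHom fun g => ?_
  rw [← coeff_charPoly, ← coeff_charPoly, h]

theorem charPoly_X {G : Type} [Group G] (g : G) : charPoly g Polynomial.X = Polynomial.X := by
  simp [charPoly]

variable {α : Type*} {W : Type} [Group W] [Finite W] [MulAction W α]

theorem finite_orbit (S : Set α) : (MulAction.orbit W S).Finite := Set.finite_range _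

/-- Orbit-stabilizer: the fibre of `y ↦ y • S` over `z • S` is the coset of `z` modulo the
stabilizer. -/
theorem sum_smul_eq_card_mul_finsum [Fintype W] (S : Set α) (F : Set α → ℚ) :
    ∑ y : W, F (y • S) =
      Nat.card (MulAction.stabilizer W S) * ∑ᶠ S' ∈ MulAction.orbit W S, F S' := by
  classical
  rw [finsum_mem_eq_finite_toFinset_sum _ (finite_orbit S), Finset.mul_sum,
    ← Finset.sum_fiberwise_of_maps_to (g := fun y : W => y • S) (fun y _ =>
      (finite_orbit S).mem_toFinset.2 (MulAction.mem_orbit S y))]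
  refine Finset.sum_congr rfl fun S' hS' => ?_
  obtain ⟨z, rfl⟩ := (finite_orbit S).mem_toFinset.1 hS'
  rw [Finset.sum_congr rfl (g := fun _ => F (z • S)) fun y hy => by rw [(Finset.mem_filter.1 hy).2],
    Finset.sum_const, nsmul_eq_mul]
  congr 2
  rw [← Nat.card_eq_finsetCard]
  refine Nat.card_congr ⟨fun y => ⟨z⁻¹ * y, ?_⟩, fun k => ⟨z * k, ?_⟩, fun y => ?_, fun k => ?_⟩
  · rw [MulAction.mem_stabilizer_iff, mul_smul, (Finset.mem_filter.1 y.2).2, inv_smul_smul]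
  · refine Finset.mem_filter.2 ⟨Finset.mem_univ _, ?_⟩
    rw [mul_smul, MulAction.mem_stabilizer_iff.1 k.2]
  · exact Subtype.ext (mul_inv_cancel_left _ _)
  · exact Subtype.ext (inv_mul_cancel_left _ _)

/-- Frobenius' formula for an induced character, with cosets of the stabilizer replaced by members
of the orbit. The family `c` records the characters of all conjugates of `f` at once; `hc` says that
they are compatible under conjugation. -/
theorem charPoly_indStab (S : Set α) (f : (VRep (MulAction.stabilizer W S))[X])
    (c : Set α → W → ℚ[X]) (hf : ∀ u : MulAction.stabilizer W S, charPoly u f = c S u)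
    (hc : ∀ x g : W, g • S = S → c (x • S) (x * g * x⁻¹) = c S g) (w : W) :
    charPoly w (indStab S f) =
      ∑ᶠ S' ∈ {S' | S' ∈ MulAction.orbit W S ∧ w • S' = S'}, c S' w := by
  classical
  have := Fintype.ofFinite W
  have hcard : (Fintype.card (MulAction.stabilizer W S) : ℚ) ≠ 0 :=
    Nat.cast_ne_zero.2 Fintype.card_ne_zero
  have hfin : {S' | S' ∈ MulAction.orbit W S ∧ w • S' = S'}.Finite :=
    (finite_orbit S).subset fun S' h => h.1
  ext n
  rw [coeff_charPoly, indStab, coeff_mapCoeff, charHom_ind]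
  -- For given `y` only `u = y * w * y⁻¹` can contribute, and it lies in the stabilizer of `S`
  -- exactly when `w` fixes `y⁻¹ • S`.
  have h1 : ∀ y : W, (∑ u : MulAction.stabilizer W S,
      if (MulAction.stabilizer W S).subtype u * y * w⁻¹ = y then charHom u (f.coeff n) else 0) =
      (fun S' => if w • S' = S' then (c S' w).coeff n else 0) (y⁻¹ • S) := fun y => by
    have hiff : w • y⁻¹ • S = y⁻¹ • S ↔ y * w * y⁻¹ ∈ MulAction.stabilizer W S := by
      rw [MulAction.mem_stabilizer_iff, mul_smul, mul_smul, eq_inv_smul_iff]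
    have heq : ∀ u : MulAction.stabilizer W S,
        (MulAction.stabilizer W S).subtype u * y * w⁻¹ = y ↔ (u : W) = y * w * y⁻¹ := fun u => by
      rw [Subgroup.subtype_apply, mul_inv_eq_iff_eq_mul, eq_mul_inv_iff_mul_eq]
    simp only [heq, hiff]
    split_ifs with h
    · rw [Finset.sum_eq_single ⟨y * w * y⁻¹, h⟩ (fun u _ hu => if_neg fun h' => hu (Subtype.ext h'))
        (fun h' => absurd (Finset.mem_univ _) h'), if_pos rfl, ← coeff_charPoly, hf,
        ← hc y⁻¹ _ h]
      congr 2
      group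
    · exact Finset.sum_eq_zero fun u _ => if_neg fun h' => h (by rw [← h']; exact u.2)
  have h2 := Equiv.sum_comp (Equiv.inv W) fun y => (fun S' => if w • S' = S' then (c S' w).coeff n else 0) (y • S)
  simp only [Equiv.inv_apply] at h2
  rw [Finset.sum_comm, Finset.sum_congr rfl fun y _ => h1 y, h2,
    sum_smul_eq_card_mul_finsum S fun S' => if w • S' = S' then (c S' w).coeff n else 0, Nat.card_eq_fintype_card, ← mul_assoc, inv_mul_cancel₀ hcard,
    one_mul, finsum_mem_eq_finite_toFinset_sum _ (finite_orbit S),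
    finsum_mem_eq_finite_toFinset_sum _ hfin, Polynomial.finsetSum_coeff, ← Finset.sum_filter]
  refine Finset.sum_congr ?_ fun _ _ => rfl
  ext S'
  simp

omit [Finite W] in
theorem mem_orbit_out_iff (q : MulAction.orbitRel.Quotient W (Set α)) (S : Set α) :
    S ∈ MulAction.orbit W q.out ↔ Quotient.mk'' S = q := by
  rw [← MulAction.orbitRel.Quotient.orbit_eq_orbit_out q Quotient.out_eq',
    MulAction.orbitRel.Quotient.mem_orbit]

omit [Finite W] in
theorem finite_subsetOrbits {p : Set α → Prop} (hfin : {S | p S}.Finite) :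
    Finite (SubsetOrbits W p) := by
  have := hfin.to_subtype
  refine Finite.of_injective (fun o : SubsetOrbits W p => (⟨o.rep, o.2⟩ : {S | p S})) ?_
  intro o o' h
  have h' : o.rep = o'.rep := congrArg Subtype.val h
  refine Subtype.ext ?_
  rw [← Quotient.out_eq o.1, ← Quotient.out_eq o'.1]
  exact congrArg _ h'

/-- On characters, a sum over orbits of induced virtual representations becomes a sum over
fixed sets. -/
theorem charPoly_finsum_indStab {p : Set α → Prop} (hp : ∀ (x : W) S, p S → p (x • S))
    (hfin : {S | p S}.Finite) (A : SubsetOrbits W p → (VRep W)[X])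
    (f : ∀ o : SubsetOrbits W p, (VRep (MulAction.stabilizer W o.rep))[X])
    (a : Set α → ℚ[X]) (c : Set α → W → ℚ[X]) (w : W)
    (hA : ∀ o, charPoly w (A o) = a o.rep) (ha : ∀ S, p S → ∀ x : W, a (x • S) = a S)
    (hf : ∀ (o : SubsetOrbits W p) (u : MulAction.stabilizer W o.rep),
      charPoly (G := MulAction.stabilizer W o.rep) u (f o) = c o.rep (u : W))
    (hc : ∀ S, p S → ∀ x g : W, g • S = S → c (x • S) (x * g * x⁻¹) = c S g) :
    charPoly w (∑ᶠ o, A o * indStab o.rep (f o)) =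
      ∑ᶠ S ∈ {S | p S ∧ w • S = S}, a S * c S w := by
  have := finite_subsetOrbits (W := W) hfin
  rw [map_finsum _ (Set.toFinite _)]
  -- The fixed sets with property `p` are split according to their orbits; invariance of `p` makes
  -- the chosen representatives satisfy it too.
  have hset : {S | p S ∧ w • S = S} = ⋃ o : SubsetOrbits W p,
      {S' | S' ∈ MulAction.orbit W o.rep ∧ w • S' = S'} := by
    ext S
    simp only [Set.mem_ofPred_eq, Set.mem_iUnion]
    constructor
    · rintro ⟨hS, hw⟩
      have hmem := (mem_orbit_out_iff (W := W) (Quotient.mk'' S) S).2 rfl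
      have hout : p (Quotient.out (Quotient.mk'' S : MulAction.orbitRel.Quotient W (Set α))) := by
        obtain ⟨x, hx⟩ := hmem
        have hx' : x • Quotient.out (Quotient.mk'' S : MulAction.orbitRel.Quotient W (Set α)) = S :=
          hx
        rw [eq_inv_smul_iff.2 hx']
        exact hp _ _ hS
      exact ⟨⟨_, hout⟩, hmem, hw⟩
    · rintro ⟨o, ⟨x, rfl⟩, hw⟩
      exact ⟨hp x _ o.2, hw⟩
  rw [hset, finsum_mem_iUnion]
  · refine finsum_congr fun o => ?_
    have hfo : {S' | S' ∈ MulAction.orbit W o.rep ∧ w • S' = S'}.Finite :=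
      (finite_orbit o.rep).subset fun S' h => h.1
    rw [map_mul, hA, charPoly_indStab o.rep (f o) c (hf o) (hc _ o.2),
      mul_finsum_mem' (fun S' => c S' w) _ hfo]
    refine finsum_mem_congr rfl ?_
    rintro _ ⟨⟨x, rfl⟩, -⟩
    rw [← ha _ o.2 x]
  · intro o o' hne
    refine Set.disjoint_left.2 ?_
    rintro S ⟨h1, -⟩ ⟨h2, -⟩
    refine hne (Subtype.ext ?_)
    exact ((mem_orbit_out_iff _ S).1 h1).symm.trans ((mem_orbit_out_iff _ S).1 h2)
  · exact fun o => (finite_orbit o.rep).subset fun S' h => h.1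

end CharacterPolynomial

end EquivariantKL

namespace EquivariantKL

open Set

/-! ### Sums over the subsets fixed by a permutation -/

section FixedSubsets

variable {α β : Type*}

/-- The subsets of `E` that are mapped to themselves by `g` and have the property `p`. -/
def fixedSubsets (g : α → α) (E : Set α) (p : Set α → Prop) : Set (Set α) :=
  {S | S ⊆ E ∧ g '' S = S ∧ p S}

theorem finite_fixedSubsets (g : α → α) {E : Set α} (hE : E.Finite) (p : Set α → Prop) :
    (fixedSubsets g E p).Finite :=
  hE.finite_subsets.subset fun _ h => h.1

/-- Transport of a sum over fixed subsets along an injective map. -/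
theorem finsum_fixedSubsets_image {A : Type*} [AddCommMonoid A] {e : α → β} {E : Set α}
    (he : InjOn e E) {g : α → α} {g' : β → β} (hg : MapsTo g E E)
    (hcomm : ∀ x ∈ E, e (g x) = g' (e x)) {p : Set α → Prop} {p' : Set β → Prop}
    (hp : ∀ S ⊆ E, p' (e '' S) ↔ p S) {F : Set α → A} {F' : Set β → A}
    (hF : ∀ S ∈ fixedSubsets g E p, F' (e '' S) = F S) :
    ∑ᶠ S' ∈ fixedSubsets g' (e '' E) p', F' S' = ∑ᶠ S ∈ fixedSubsets g E p, F S := by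
  have himg : ∀ S ⊆ E, g' '' (e '' S) = e '' (g '' S) := fun S hS => by
    rw [image_image, image_image]
    exact image_congr fun x hx => (hcomm x (hS hx)).symm
  refine (finsum_mem_eq_of_bijOn (e '' ·) ⟨?_, ?_, ?_⟩ fun S hS => (hF S hS).symm).symm
  · rintro S ⟨hS, hgS, hpS⟩
    exact ⟨image_mono hS, by rw [himg S hS, hgS], (hp S hS).2 hpS⟩
  · rintro S hS T hT h
    exact (he.image_eq_image_iff hS.1 hT.1).1 h
  · rintro S' ⟨hS', hgS', hpS'⟩
    obtain ⟨S, hS, rfl⟩ := subset_image_iff.1 hS'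
    rw [himg S hS] at hgS'
    refine ⟨S, ⟨hS, ?_, (hp S hS).1 hpS'⟩, rfl⟩
    exact (he.image_eq_image_iff ((image_mono hS).trans hg.image_subset) hS).1 hgS'

end FixedSubsets

/-! ### Minors and ranks under injective relabelling -/

section MapMinor

variable {α β : Type*}

/-- Independence in a contraction is decided by a basis of `S`, and `e` carries such a basis to a
basis of the image. -/
theorem contract_map (M : Matroid α) {e : α → β} (he : InjOn e M.E) {S : Set α} (hS : S ⊆ M.E) :
    (M.map e he).contract (e '' S) = (M.contract S).map e (he.mono sdiff_subset) := by
  refine Matroid.ext_indep ?_ fun I hI => ?_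
  · rw [Matroid.contract_ground, Matroid.map_ground, Matroid.map_ground, Matroid.contract_ground,
      he.image_sdiff_subset hS]
  · obtain ⟨J, hJ⟩ := M.exists_isBasis S
    rw [Matroid.contract_ground, Matroid.map_ground, ← he.image_sdiff_subset hS] at hI
    obtain ⟨I, hI', rfl⟩ := subset_image_iff.1 hI
    have hIE : I ⊆ M.E := hI'.trans sdiff_subset
    have hd : Disjoint S I := (disjoint_sdiff_left.mono_left hI').symm
    have hd' : Disjoint (e '' S) (e '' I) := by
      rw [he.image_sdiff_subset hS] at hI
      exact (disjoint_sdiff_left.mono_left hI).symm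
    rw [(hJ.map he).contract_indep_iff_of_disjoint hd', Matroid.map_image_indep_iff hI',
      hJ.contract_indep_iff_of_disjoint hd, ← image_union,
      Matroid.map_image_indep_iff (union_subset hIE hJ.indep.subset_ground)]

theorem restrict_map (M : Matroid α) {e : α → β} (he : InjOn e M.E) {S : Set α} (hS : S ⊆ M.E) :
    (M.map e he).restrict (e '' S) = (M.restrict S).map e (he.mono hS) := by
  refine Matroid.ext_indep rfl fun I hI => ?_
  obtain ⟨I, hI', rfl⟩ := subset_image_iff.1 hI
  rw [Matroid.restrict_indep_iff, Matroid.map_image_indep_iff (hI'.trans hS),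
    Matroid.map_image_indep_iff hI', Matroid.restrict_indep_iff]
  exact ⟨fun h => ⟨h.1, hI'⟩, fun h => ⟨h.1, hI⟩⟩

theorem rank_map (M : Matroid α) {e : α → β} (he : InjOn e M.E) : rank (M.map e he) = rank M := by
  rw [rank, rank, Matroid.eRank_map]

theorem rk_map (M : Matroid α) {e : α → β} (he : InjOn e M.E) {S : Set α} (hS : S ⊆ M.E) :
    rk (M.map e he) (e '' S) = rk M S := by
  rw [rk, rk, Matroid.eRk_map M he hS]

end MapMinor

/-! ### The recursions for a single permutation, without a group -/

section Numerical

variable {α β : Type*}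

open scoped Classical in
/-- The character value at `g` of the equivariant Kazhdan-Lusztig polynomial. -/
noncomputable def numKL (g : α → α) (M : Matroid α) : ℚ[X] :=
  -- Finiteness is tested only to make the recursion terminate; on an infinite ground set the value
  -- is a default.
  if h : M.E.Finite ∧ M.E.Nonempty then
    palindromicCorrection (rank M) (∑ᶠ S : fixedSubsets g M.E Set.Nonempty,
      Polynomial.X ^ rk M S * numKL g (M.contract S))
  else 1
termination_by M.E.ncard
decreasing_by
  obtain ⟨hS, -, x, hx⟩ := S.2
  exact ncard_lt_ncard ⟨sdiff_subset, fun h => (h (hS hx)).2 hx⟩ h.1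

/-- The sum over nonempty fixed subsets in the recursion of `numKL`. -/
noncomputable def numRest (g : α → α) (M : Matroid α) : ℚ[X] :=
  ∑ᶠ S ∈ fixedSubsets g M.E Set.Nonempty, Polynomial.X ^ rk M S * numKL g (M.contract S)

/-- The character value at `g` of the equivariant `Z`-polynomial. -/
noncomputable def numZ (g : α → α) (M : Matroid α) : ℚ[X] := numKL g M + numRest g M

open scoped Classical in
/-- The character value at `g` of the equivariant inverse Kazhdan-Lusztig polynomial. -/
noncomputable def numInv (g : α → α) (M : Matroid α) : ℚ[X] :=
  if h : M.E.Finite ∧ M.E.Nonempty then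
    -((-1) ^ rank M * ∑ᶠ S : fixedSubsets g M.E (· ≠ M.E),
      (-1) ^ rk M S * (numInv g (M.restrict S) * numKL g (M.contract S)))
  else 1
termination_by M.E.ncard
decreasing_by
  exact ncard_lt_ncard (S.2.1.ssubset_of_ne S.2.2.2) h.1

theorem numKL_eq (g : α → α) {M : Matroid α} (hf : M.E.Finite) (hne : M.E.Nonempty) :
    numKL g M = palindromicCorrection (rank M) (numRest g M) := by
  rw [numKL, dif_pos ⟨hf, hne⟩, numRest, ← finsum_set_coe_eq_finsum_mem]

theorem numKL_of_empty (g : α → α) {M : Matroid α} (h : M.E = ∅) : numKL g M = 1 := by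
  rw [numKL, dif_neg fun h' => h'.2.ne_empty h]

theorem numInv_eq (g : α → α) {M : Matroid α} (hf : M.E.Finite) (hne : M.E.Nonempty) :
    numInv g M = -((-1) ^ rank M * ∑ᶠ S ∈ fixedSubsets g M.E (· ≠ M.E),
      (-1) ^ rk M S * (numInv g (M.restrict S) * numKL g (M.contract S))) := by
  rw [numInv, dif_pos ⟨hf, hne⟩, ← finsum_set_coe_eq_finsum_mem]

theorem numInv_of_empty (g : α → α) {M : Matroid α} (h : M.E = ∅) : numInv g M = 1 := by
  rw [numInv, dif_neg fun h' => h'.2.ne_empty h]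

theorem mapsTo_sdiff_of_image_eq {g : α → α} {E S : Set α} (hg : MapsTo g E E) (hi : InjOn g E)
    (hS : S ⊆ E) (hgS : g '' S = S) : MapsTo g (E \ S) (E \ S) := by
  refine fun x hx => ⟨hg hx.1, fun h => hx.2 ?_⟩
  rw [← hgS] at h
  obtain ⟨y, hy, hyx⟩ := h
  rwa [← hi (hS hy) hx.1 hyx]

/-- The Kazhdan-Lusztig polynomial is invariant under isomorphisms. -/
theorem numKL_map {M : Matroid α} (hf : M.E.Finite) {e : α → β} (he : InjOn e M.E) {g : α → α}
    {g' : β → β} (hg : MapsTo g M.E M.E) (hi : InjOn g M.E)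
    (hcomm : ∀ x ∈ M.E, e (g x) = g' (e x)) : numKL g' (M.map e he) = numKL g M := by
  induction hn : M.E.ncard using Nat.strong_induction_on generalizing M with
  | _ n ih =>
  rcases M.E.eq_empty_or_nonempty with h0 | hne
  · rw [numKL_of_empty g h0, numKL_of_empty g' (by rw [Matroid.map_ground, h0, image_empty])]
  rw [numKL_eq g hf hne, numKL_eq g' (hf.image e) (hne.image e), rank_map, numRest, numRest,
    Matroid.map_ground]
  congr 1
  refine finsum_fixedSubsets_image he hg hcomm (fun S _ => image_nonempty) ?_
  rintro S ⟨hS, hgS, x, hx⟩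
  rw [rk_map M he hS, contract_map M he hS]
  congr 1
  refine ih _ ?_ (hf.subset sdiff_subset) _ (mapsTo_sdiff_of_image_eq hg hi hS hgS)
    (hi.mono sdiff_subset) (fun x hx => hcomm x hx.1) rfl
  rw [← hn]
  exact ncard_lt_ncard ⟨sdiff_subset, fun h => (h (hS hx)).2 hx⟩ hf

/-- The inverse Kazhdan-Lusztig polynomial is invariant under isomorphisms. -/
theorem numInv_map {M : Matroid α} (hf : M.E.Finite) {e : α → β} (he : InjOn e M.E) {g : α → α}
    {g' : β → β} (hg : MapsTo g M.E M.E) (hi : InjOn g M.E)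
    (hcomm : ∀ x ∈ M.E, e (g x) = g' (e x)) : numInv g' (M.map e he) = numInv g M := by
  induction hn : M.E.ncard using Nat.strong_induction_on generalizing M with
  | _ n ih =>
  rcases M.E.eq_empty_or_nonempty with h0 | hne
  · rw [numInv_of_empty g h0, numInv_of_empty g' (by rw [Matroid.map_ground, h0, image_empty])]
  rw [numInv_eq g hf hne, numInv_eq g' (hf.image e) (hne.image e), rank_map, Matroid.map_ground]
  congr 2
  refine finsum_fixedSubsets_image he hg hcomm
    (fun S hS => not_congr (he.image_eq_image_iff hS Subset.rfl)) ?_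
  rintro S ⟨hS, hgS, hne⟩
  rw [rk_map M he hS, contract_map M he hS, restrict_map M he hS]
  congr 2
  · refine ih _ ?_ (hf.subset hS) _ (mapsTo_iff_image_subset.2 hgS.subset) (hi.mono hS)
      (fun x hx => hcomm x (hS hx)) rfl
    rw [← hn]
    exact ncard_lt_ncard (hS.ssubset_of_ne hne) hf
  · exact numKL_map (M := M.contract S) (hf.subset sdiff_subset) _
      (mapsTo_sdiff_of_image_eq hg hi hS hgS) (hi.mono sdiff_subset) (fun x hx => hcomm x hx.1)

end Numerical

/-! ### The numerical polynomials are the characters of the equivariant ones -/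

section Comparison

variable {α : Type*} {W : Type} [Group W] [MulAction W α]

theorem IsSymmetric.map_eq {M : Matroid α} (h : IsSymmetric W M) (w : W) :
    M.map (w • ·) (MulAction.injective w).injOn = M := h.mapEquiv_eq w

theorem isSymmetric_of_map_eq {M : Matroid α}
    (h : ∀ w : W, M.map (w • ·) (MulAction.injective w).injOn = M) : IsSymmetric W M := by
  refine fun w => ⟨congrArg Matroid.E (h w), fun B hB => ?_⟩
  rw [← h w]
  exact hB.map _

theorem IsSymmetric.contract_smul {M : Matroid α} (h : IsSymmetric W M) {S : Set α}
    (hS : S ⊆ M.E) (w : W) : M.contract (w • S) =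
      (M.contract S).map (w • ·) (MulAction.injective w).injOn := by
  conv_lhs => rw [← h.map_eq w]
  exact contract_map M _ hS

theorem IsSymmetric.restrict_smul {M : Matroid α} (h : IsSymmetric W M) {S : Set α}
    (hS : S ⊆ M.E) (w : W) : M.restrict (w • S) =
      (M.restrict S).map (w • ·) (MulAction.injective w).injOn := by
  conv_lhs => rw [← h.map_eq w]
  exact restrict_map M _ hS

theorem IsSymmetric.rk_smul {M : Matroid α} (h : IsSymmetric W M) {S : Set α}
    (hS : S ⊆ M.E) (w : W) : rk M (w • S) = rk M S := by
  conv_lhs => rw [← h.map_eq w]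
  exact rk_map M _ hS

theorem IsSymmetric.contract {M : Matroid α} (h : IsSymmetric W M) {S : Set α} (hS : S ⊆ M.E) :
    IsSymmetric (MulAction.stabilizer W S) (M.contract S) :=
  isSymmetric_of_map_eq fun w => by
    conv_rhs => rw [← show (w : W) • S = S from w.2, h.contract_smul hS w]
    rfl

theorem IsSymmetric.restrict {M : Matroid α} (h : IsSymmetric W M) {S : Set α} (hS : S ⊆ M.E) :
    IsSymmetric (MulAction.stabilizer W S) (M.restrict S) :=
  isSymmetric_of_map_eq fun w => by
    conv_rhs => rw [← show (w : W) • S = S from w.2, h.restrict_smul hS w]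
    rfl

theorem mapsTo_smul_sdiff {E S : Set α} {w : W} (hE : w • E = E) (hS : w • S = S) :
    MapsTo (w • ·) (E \ S) (E \ S) := by
  refine mapsTo_iff_image_subset.2 ?_
  change w • (E \ S) ⊆ _
  rw [smul_set_sdiff, hE, hS]

variable [Finite W]

theorem charPoly_palindromicCorrection {G : Type} [Group G] (g : G) (k : ℕ) (R : (VRep G)[X]) :
    charPoly g (palindromicCorrection k R) = palindromicCorrection k (charPoly g R) := by
  ext n
  rw [coeff_charPoly, coeff_palindromicCorrection, coeff_palindromicCorrection]
  split_ifs <;> simp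

/-- The character formula for proper contractions is taken as a hypothesis, so that the lemma serves
both the induction for `P` and, afterwards, the formula for `Z`. -/
theorem charPoly_klRest_of_charPoly_klPoly {M : Matroid α} [M.Finite]
    (h : IsSymmetric W M) (ih : ∀ S, S ⊆ M.E → S.Nonempty → ∀ u : MulAction.stabilizer W S,
      charPoly (G := MulAction.stabilizer W S) u (klPoly (MulAction.stabilizer W S) (M.contract S)) =
        numKL ((u : W) • ·) (M.contract S)) (w : W) :
    charPoly w (klRest W M) = numRest (w • ·) M := by
  rw [klRest, charPoly_finsum_indStab (a := fun S => Polynomial.X ^ rk M S)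
    (c := fun S w => numKL (w • ·) (M.contract S))]
  · rw [numRest]
    refine finsum_mem_congr ?_ fun _ _ => rfl
    ext S
    exact ⟨fun hS => ⟨hS.1.1, hS.2, hS.1.2⟩, fun hS => ⟨⟨hS.1, hS.2.2⟩, hS.2.1⟩⟩
  · rintro x S ⟨hS, hne⟩
    exact ⟨by rw [← (h x).1]; exact smul_set_mono hS, hne.smul_set⟩
  · exact M.ground_finite.finite_subsets.subset fun S hS => hS.1
  · intro o
    rw [map_pow, charPoly_X]
  · intro S hS x
    rw [h.rk_smul hS.1]
  · intro o u
    exact ih o.rep o.2.1 o.2.2 u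
  · intro S hS x g hg
    rw [h.contract_smul hS.1 x]
    refine numKL_map (M.ground_finite.subset sdiff_subset) _
      (mapsTo_smul_sdiff (h g).1 hg) (MulAction.injective g).injOn fun y _ => ?_
    simp [mul_smul]

/-- The character of the equivariant Kazhdan-Lusztig polynomial. -/
theorem charPoly_klPoly {W : Type} [Group W] [Finite W] [MulAction W α] {M : Matroid α} [M.Finite]
    (h : IsSymmetric W M) (w : W) : charPoly w (klPoly W M) = numKL (w • ·) M := by
  induction hn : M.E.ncard using Nat.strong_induction_on generalizing M W with
  | _ n ih =>
  rcases M.E.eq_empty_or_nonempty with h0 | hne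
  · rw [klPoly_of_empty W M h0, numKL_of_empty _ h0, map_one]
  rw [klPoly_eq W M hne.ne_empty, numKL_eq _ M.ground_finite hne, charPoly_palindromicCorrection,
    charPoly_klRest_of_charPoly_klPoly h]
  rintro S hS ⟨x, hx⟩ u
  refine ih _ ?_ (h.contract hS) u rfl
  rw [← hn]
  exact ncard_lt_ncard ⟨sdiff_subset, fun h => (h (hS hx)).2 hx⟩ M.ground_finite

theorem charPoly_zPoly {M : Matroid α} [M.Finite] (h : IsSymmetric W M) (w : W) :
    charPoly w (zPoly W M) = numZ (w • ·) M := by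
  rw [zPoly, numZ, map_add, charPoly_klPoly h,
    charPoly_klRest_of_charPoly_klPoly h fun S hS _ u => charPoly_klPoly (h.contract hS) u]

/-- The character of the equivariant inverse Kazhdan-Lusztig polynomial. -/
theorem charPoly_invKlPoly {W : Type} [Group W] [Finite W] [MulAction W α] {M : Matroid α}
    [M.Finite] (h : IsSymmetric W M) (w : W) :
    charPoly w (invKlPoly W M) = numInv (w • ·) M := by
  induction hn : M.E.ncard using Nat.strong_induction_on generalizing M W with
  | _ n ih =>
  rcases M.E.eq_empty_or_nonempty with h0 | hne
  · rw [invKlPoly, if_pos h0, numInv_of_empty _ h0, map_one]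
  rw [invKlPoly, if_neg hne.ne_empty, numInv_eq _ M.ground_finite hne, map_neg, map_mul, map_pow,
    map_neg, map_one, charPoly_finsum_indStab (a := fun S => (-1) ^ rk M S)
    (c := fun S w => numInv (w • ·) (M.restrict S) * numKL (w • ·) (M.contract S))]
  · congr 2
    refine finsum_mem_congr ?_ fun _ _ => rfl
    ext S
    exact ⟨fun hS => ⟨hS.1.subset, hS.2, hS.1.ne⟩,
      fun hS => ⟨hS.1.ssubset_of_ne hS.2.2, hS.2.1⟩⟩
  · intro x S hS
    rw [← (h x).1]
    exact ⟨smul_set_mono hS.1, fun h' => hS.2 (smul_set_subset_smul_set_iff.1 h')⟩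
  · exact M.ground_finite.finite_subsets.subset fun S hS => hS.1
  · intro o
    rw [map_pow, map_neg, map_one]
  · intro S hS x
    rw [h.rk_smul hS.1]
  · intro o u
    have := M.restrict_finite (M.ground_finite.subset o.2.subset)
    rw [map_mul, charPoly_klPoly (h.contract o.2.1), ih _ ?_ (h.restrict o.2.1) u rfl]
    · rfl
    · rw [← hn]
      exact ncard_lt_ncard o.2 M.ground_finite
  · intro S hS x g hg
    rw [h.contract_smul hS.1 x, h.restrict_smul hS.1 x]
    congr 1
    · refine numInv_map (M.ground_finite.subset hS.1) _ (mapsTo_iff_image_subset.2 hg.subset)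
        (MulAction.injective g).injOn fun y _ => ?_
      simp [mul_smul]
    · refine numKL_map (M.ground_finite.subset sdiff_subset) _
        (mapsTo_smul_sdiff (h g).1 hg) (MulAction.injective g).injOn fun y _ => ?_
      simp [mul_smul]

end Comparison

end EquivariantKL

namespace EquivariantKL

open Set

/-! ### The local contribution of one fixed hyperplane -/

section Relative

variable {α β : Type*}

/-- The contribution of a fixed stressed hyperplane `X` of a matroid of rank `k` to the change
of the Kazhdan-Lusztig polynomial under relaxation. -/
noncomputable def relKL (g : α → α) (k : ℕ) (X : Set α) : ℚ[X] :=
  palindromicCorrection k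
    -- The sum comes from the small independent sets. The term `-X ^ (k - 1)` comes from `S = X`,
    -- which has rank `k - 1` and contributes `X ^ (k - 1)` before relaxation and nothing
    -- afterwards.
    ((∑ᶠ S : fixedSubsets g X (fun S => S.Nonempty ∧ S.encard < k),
      Polynomial.X ^ S.1.ncard * relKL g (k - S.1.ncard) (X \ S.1)) - Polynomial.X ^ (k - 1))
termination_by k
decreasing_by
  have hfin : S.1.Finite := encard_lt_top_iff.1 (S.2.2.2.2.trans (ENat.natCast_lt_top k))
  have h1 := S.2.2.2.2
  rw [← hfin.cast_ncard_eq, Nat.cast_lt] at h1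
  have h2 := (ncard_pos hfin).2 S.2.2.2.1
  omega

/-- The contribution of `X` to the change of the sum over nonempty subsets. -/
noncomputable def relRest (g : α → α) (k : ℕ) (X : Set α) : ℚ[X] :=
  (∑ᶠ S ∈ fixedSubsets g X (fun S => S.Nonempty ∧ S.encard < k),
    Polynomial.X ^ S.ncard * relKL g (k - S.ncard) (X \ S)) - Polynomial.X ^ (k - 1)

theorem relKL_eq (g : α → α) (k : ℕ) (X : Set α) :
    relKL g k X = palindromicCorrection k (relRest g k X) := by
  rw [relKL, relRest, ← finsum_set_coe_eq_finsum_mem]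

/-- The recursion sees only the permutation induced on `X`. This gives both invariance under
conjugation and the transfer to the model example. -/
theorem relKL_image {e : α → β} {X : Set α} {k : ℕ} (he : InjOn e X) {g : α → α} {g' : β → β}
    (hg : MapsTo g X X) (hi : InjOn g X) (hcomm : ∀ x ∈ X, e (g x) = g' (e x)) :
    relKL g' k (e '' X) = relKL g k X := by
  induction k using Nat.strong_induction_on generalizing X with
  | _ k ih =>
  rw [relKL_eq, relKL_eq, relRest, relRest]
  congr 2
  refine finsum_fixedSubsets_image he hg hcomm (fun S hS => ?_) ?_
  · rw [image_nonempty, (he.mono hS).encard_image]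
  · rintro S ⟨hS, hgS, hne, hlt⟩
    have hfin : S.Finite := encard_lt_top_iff.1 (hlt.trans (ENat.natCast_lt_top k))
    rw [← hfin.cast_ncard_eq, Nat.cast_lt] at hlt
    have hpos := (ncard_pos hfin).2 hne
    rw [(he.mono hS).ncard_image, ← he.image_sdiff_subset hS]
    congr 1
    exact ih _ (by omega) (he.mono sdiff_subset) (mapsTo_sdiff_of_image_eq hg hi hS hgS)
      (hi.mono sdiff_subset) fun x hx => hcomm x hx.1

theorem relRest_image {e : α → β} {X : Set α} {k : ℕ} (he : InjOn e X) {g : α → α} {g' : β → β}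
    (hg : MapsTo g X X) (hi : InjOn g X) (hcomm : ∀ x ∈ X, e (g x) = g' (e x)) :
    relRest g' k (e '' X) = relRest g k X := by
  rw [relRest, relRest]
  congr 1
  refine finsum_fixedSubsets_image he hg hcomm (fun S hS => ?_) ?_
  · rw [image_nonempty, (he.mono hS).encard_image]
  · rintro S ⟨hS, hgS, hne, hlt⟩
    rw [(he.mono hS).ncard_image, ← he.image_sdiff_subset hS,
      relKL_image (he.mono sdiff_subset) (mapsTo_sdiff_of_image_eq hg hi hS hgS)
      (hi.mono sdiff_subset) fun x hx => hcomm x hx.1]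

/-- The contribution of a fixed stressed hyperplane of a matroid of rank `k` to the change
of the inverse Kazhdan-Lusztig polynomial; `N` is the restriction to the hyperplane. -/
noncomputable def relInv (g : α → α) (k : ℕ) (N : Matroid α) : ℚ[X] :=
  -- The empty set is included here, unlike in `relRest`: its summand accounts for the change of `P`
  -- of the whole matroid. The last term is again that of the hyperplane itself.
  -((-1) ^ k * ((∑ᶠ S ∈ fixedSubsets g N.E (fun S => S.encard < k),
    (-1) ^ S.ncard * (numInv g (N.restrict S) * relKL g (k - S.ncard) (N.E \ S))) -
      (-1) ^ (k - 1) * numInv g N))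

theorem relInv_map {N : Matroid α} (hf : N.E.Finite) {e : α → β} (he : InjOn e N.E) {k : ℕ}
    {g : α → α} {g' : β → β} (hg : MapsTo g N.E N.E) (hi : InjOn g N.E)
    (hcomm : ∀ x ∈ N.E, e (g x) = g' (e x)) : relInv g' k (N.map e he) = relInv g k N := by
  rw [relInv, relInv, numInv_map hf he hg hi hcomm, Matroid.map_ground]
  congr 3
  refine finsum_fixedSubsets_image he hg hcomm (fun S hS => ?_) ?_
  · rw [(he.mono hS).encard_image]
  · rintro S ⟨hS, hgS, hlt⟩
    rw [(he.mono hS).ncard_image, ← he.image_sdiff_subset hS,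
      relKL_image (he.mono sdiff_subset) (mapsTo_sdiff_of_image_eq hg hi hS hgS)
      (hi.mono sdiff_subset) fun x hx => hcomm x hx.1, restrict_map N he hS,
      numInv_map (M := N.restrict S) (hf.subset hS) _ (mapsTo_iff_image_subset.2 hgS.subset)
        (hi.mono hS) fun x hx => hcomm x (hS hx)]

end Relative

/-! ### Ranks and minors of a relaxation -/

section Relaxation

variable {α : Type*}

/-- `M'` is obtained from the matroid `M` of rank `k` by relaxing the stressed hyperplanes in `F`,
which have at least `k` elements. -/
structure IsRelaxation (M M' : Matroid α) (F : Set (Set α)) (k : ℕ) : Prop where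
  finite : M.E.Finite
  ground_eq : M'.E = M.E
  eRank_eq : M.eRank = k
  isFlat : ∀ H ∈ F, M.IsFlat H
  le_encard : ∀ H ∈ F, (k : ℕ∞) ≤ H.encard
  indep_iff : ∀ H ∈ F, ∀ I ⊆ H, M.Indep I ↔ I.encard < k
  relax_indep_iff : ∀ I, M'.Indep I ↔ M.Indep I ∨ ∃ H ∈ F, I ⊆ H ∧ I.encard = k

namespace IsRelaxation

variable {M M' : Matroid α} {F : Set (Set α)} {k : ℕ} {H H' S : Set α}

theorem indep_relax (h : IsRelaxation M M' F k) {I : Set α} (hI : M.Indep I) : M'.Indep I :=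
  (h.relax_indep_iff I).2 (Or.inl hI)

theorem subset_ground (h : IsRelaxation M M' F k) (hH : H ∈ F) : H ⊆ M.E :=
  (h.isFlat H hH).subset_ground

/-- A set of `k - 1` elements of `H` is independent, while adding any further element of `H` gives
`k` elements and hence a dependent set. -/
theorem closure_eq (h : IsRelaxation M M' F k) (hH : H ∈ F) {I : Set α} (hI : I ⊆ H)
    (hc : I.encard + 1 = k) : M.closure I = H := by
  refine ((M.closure_subset_closure hI).trans (h.isFlat H hH).closure.subset).antisymm ?_
  have hlt : I.encard < k := by
    rw [← hc, ENat.lt_add_one_iff]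
    intro h'
    rw [h', top_add] at hc
    exact ENat.top_ne_natCast _ hc
  have hind := (h.indep_iff H hH I hI).2 hlt
  intro x hx
  by_contra hcl
  have hxI : x ∉ I := fun h' => hcl (M.mem_closure_of_mem h' hind.subset_ground)
  have h1 : M.Indep (insert x I) := by
    rw [Matroid.insert_indep_iff]
    exact ⟨hind, fun _ => ⟨h.subset_ground hH hx, hcl⟩⟩
  rw [h.indep_iff H hH _ (insert_subset hx hI), encard_insert_of_notMem hxI, hc] at h1
  exact lt_irrefl _ h1

/-- Both hyperplanes are the closure of the same `k - 1` elements of `S`. -/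
theorem eq_of_subset (h : IsRelaxation M M' F k) (hk : 1 ≤ k) (hH : H ∈ F) (hH' : H' ∈ F)
    (hS : S ⊆ H) (hS' : S ⊆ H') (hc : (k : ℕ∞) ≤ S.encard + 1) : H = H' := by
  have h1 : ((k - 1 : ℕ) : ℕ∞) ≤ S.encard := by
    rw [← ENat.add_le_add_iff_right ENat.one_ne_top]
    refine le_trans (le_of_eq ?_) hc
    exact_mod_cast Nat.sub_add_cancel hk
  obtain ⟨I, hI, hIc⟩ := exists_subset_encard_eq h1
  have hIc' : I.encard + 1 = k := by
    rw [hIc]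
    exact_mod_cast Nat.sub_add_cancel hk
  rw [← h.closure_eq hH (hI.trans hS) hIc', h.closure_eq hH' (hI.trans hS') hIc']

/-- If adding an element made the basis `I` a new independent set, `I` would lie in some member of
`F`, and so would its closure, which contains `S`. -/
theorem isBasis_of_forall_not_subset (h : IsRelaxation M M' F k) (hS : ∀ H ∈ F, ¬ S ⊆ H)
    {I : Set α} (hI : M.IsBasis I S) : M'.IsBasis I S := by
  refine (h.indep_relax hI.indep).isBasis_of_forall_insert hI.subset fun x hx => ?_
  rw [Matroid.dep_iff, h.ground_eq]
  refine ⟨fun h' => ?_, (insert_subset hx.1 hI.subset).trans hI.subset_ground⟩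
  rcases (h.relax_indep_iff _).1 h' with h' | ⟨H, hH, hIH, hc⟩
  · exact hx.2 (hI.mem_of_insert_indep hx.1 h')
  · refine hS H hH (hI.subset_closure.trans ?_)
    exact (M.closure_subset_closure ((subset_insert _ _).trans hIH)).trans
      (h.isFlat H hH).closure.subset

theorem rk_eq_of_forall_not_subset (h : IsRelaxation M M' F k) (hS : ∀ H ∈ F, ¬ S ⊆ H)
    (hSE : S ⊆ M.E) : rk M' S = rk M S := by
  obtain ⟨I, hI⟩ := M.exists_isBasis S
  rw [rk, rk, ← hI.encard_eq_eRk, ← (h.isBasis_of_forall_not_subset hS hI).encard_eq_eRk]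

theorem contract_eq_of_forall_not_subset (h : IsRelaxation M M' F k) (hS : ∀ H ∈ F, ¬ S ⊆ H)
    (hSE : S ⊆ M.E) : M'.contract S = M.contract S := by
  obtain ⟨I, hI⟩ := M.exists_isBasis S
  refine Matroid.ext_indep (by simp [h.ground_eq]) fun J hJ => ?_
  have hd : Disjoint S J := (disjoint_sdiff_left.mono_left hJ).symm
  rw [(h.isBasis_of_forall_not_subset hS hI).contract_indep_iff_of_disjoint hd,
    hI.contract_indep_iff_of_disjoint hd, h.relax_indep_iff, or_iff_left]
  rintro ⟨H, hH, hIH, -⟩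
  refine hS H hH (hI.subset_closure.trans ?_)
  exact (M.closure_subset_closure (subset_union_right.trans hIH)).trans
    (h.isFlat H hH).closure.subset

/-- A new independent set inside `S` has `k` elements and lies in some `H`. Removing a point leaves
an independent set of `k - 1` elements, which spans `S` since the rank of `S` is below `k`, but
whose closure is `H`; this would force `S ⊆ H`. -/
theorem restrict_eq_of_forall_not_subset (h : IsRelaxation M M' F k) (hk : 1 ≤ k)
    (hS : ∀ H ∈ F, ¬ S ⊆ H) (hSE : S ⊆ M.E) (hlt : rk M S < k) :
    M'.restrict S = M.restrict S := by
  refine Matroid.ext_indep rfl fun I hI => ?_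
  rw [Matroid.restrict_indep_iff, Matroid.restrict_indep_iff, h.relax_indep_iff]
  refine and_congr_left fun _ => or_iff_left ?_
  rintro ⟨H, hH, hIH, hc⟩
  obtain ⟨x, hx⟩ : I.Nonempty := by
    rw [← encard_ne_zero, hc]
    exact_mod_cast (by omega : k ≠ 0)
  have hc' : (I \ {x}).encard + 1 = k := by rw [encard_sdiff_singleton_add_one hx, hc]
  have hcl := h.closure_eq hH (sdiff_subset.trans hIH) hc'
  have hfin : (I \ {x}).Finite := h.finite.subset (sdiff_subset.trans (hIH.trans (h.subset_ground hH)))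
  have hind : M.Indep (I \ {x}) := by
    rw [h.indep_iff H hH _ (sdiff_subset.trans hIH), ← hc', ENat.lt_add_one_iff hfin.encard_lt_top.ne]
  have hbas : M.IsBasis (I \ {x}) S := by
    refine hind.isBasis_of_eRk_ge hfin (sdiff_subset.trans hI) ?_ hSE
    have hfS : M.eRk S ≠ ⊤ := ((M.eRk_le_encard S).trans_lt (h.finite.subset hSE).encard_lt_top).ne
    rw [hind.eRk_eq_encard]
    rw [rk] at hlt
    have h1 : M.eRk S < k := by rwa [← ENat.natCast_toNat hfS, Nat.cast_lt]
    rwa [← hc', ENat.lt_add_one_iff hfin.encard_lt_top.ne] at h1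
  exact hS H hH (hcl ▸ hbas.subset_closure)

theorem restrict_eq_of_subset (h : IsRelaxation M M' F k) (hH : H ∈ F) (hS : S ⊆ H)
    (hlt : S.encard < k) : M'.restrict S = M.restrict S := by
  have hind := (h.indep_iff H hH S hS).2 hlt
  refine Matroid.ext_indep rfl fun I hI => ?_
  rw [Matroid.restrict_indep_iff, Matroid.restrict_indep_iff]
  exact ⟨fun _ => ⟨hind.subset hI, hI⟩, fun _ => ⟨h.indep_relax (hind.subset hI), hI⟩⟩

theorem rk_of_subset (h : IsRelaxation M M' F k) (hH : H ∈ F) (hS : S ⊆ H)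
    (hlt : S.encard < k) : rk M S = S.ncard :=
  congrArg ENat.toNat ((h.indep_iff H hH S hS).2 hlt).eRk_eq_encard

theorem rk_relax_of_subset (h : IsRelaxation M M' F k) (hH : H ∈ F) (hS : S ⊆ H)
    (hlt : S.encard < k) : rk M' S = S.ncard :=
  congrArg ENat.toNat (h.indep_relax ((h.indep_iff H hH S hS).2 hlt)).eRk_eq_encard

theorem eRank_relax_eq (h : IsRelaxation M M' F k) : M'.eRank = k := by
  obtain ⟨B, hB⟩ := M.exists_isBase
  obtain ⟨B', hB', hBB'⟩ := (h.indep_relax hB.indep).exists_isBase_superset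
  refine le_antisymm ?_ ?_
  · rw [← hB'.encard_eq_eRank]
    rcases (h.relax_indep_iff B').1 hB'.indep with h1 | ⟨-, -, -, h1⟩
    · rw [← h.eRank_eq]
      exact h1.encard_le_eRank
    · exact h1.le
  · rw [← hB'.encard_eq_eRank, ← h.eRank_eq, ← hB.encard_eq_eRank]
    exact encard_le_encard hBB'

theorem rank_eq (h : IsRelaxation M M' F k) : rank M = k := by
  rw [rank, h.eRank_eq, ENat.toNat_natCast]

theorem rank_relax_eq (h : IsRelaxation M M' F k) : rank M' = k := by
  rw [rank, h.eRank_relax_eq, ENat.toNat_natCast]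

/-- Contraction of a small subset of a hyperplane. -/
theorem contract (h : IsRelaxation M M' F k) (hH : H ∈ F) (hS : S ⊆ H)
    (hlt : S.encard < k) : IsRelaxation (M.contract S) (M'.contract S)
      ((· \ S) '' {H' | H' ∈ F ∧ S ⊆ H'}) (k - S.ncard) := by
  -- As `S` is independent in both matroids, independence of `I` in either contraction means being
  -- disjoint from `S` with `I ∪ S` independent. All cardinalities therefore shift by that of `S`.
  have hind := (h.indep_iff H hH S hS).2 hlt
  have hSE := hind.subset_ground
  have hSf : S.Finite := h.finite.subset hSE
  have hlt' : S.ncard < k := by rwa [← hSf.cast_ncard_eq, Nat.cast_lt] at hlt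
  have hadd : ((k - S.ncard : ℕ) : ℕ∞) + S.encard = k := by
    rw [← hSf.cast_ncard_eq]
    exact_mod_cast Nat.sub_add_cancel hlt'.le
  have hStop : S.encard ≠ ⊤ := hSf.encard_lt_top.ne
  refine ⟨h.finite.subset sdiff_subset, by simp [h.ground_eq], ?_, ?_, ?_, ?_, ?_⟩
  · have : M.Finite := ⟨h.finite⟩
    have h1 := rank_contract_add M hSE
    rw [h.rank_eq, h.rk_of_subset hH hS hlt] at h1
    have h2 : (M.contract S).eRank ≠ ⊤ := by
      rw [Matroid.eRank_ne_top_iff]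
      infer_instance
    rw [← ENat.natCast_toNat h2]
    change (rank (M.contract S) : ℕ∞) = _
    exact_mod_cast (by omega : rank (M.contract S) = k - S.ncard)
  · rintro _ ⟨H', ⟨hH', hSH'⟩, rfl⟩
    rw [Matroid.isFlat_iff_closure_eq, Matroid.contract_closure_eq, sdiff_union_of_subset hSH',
      (h.isFlat H' hH').closure]
  · rintro _ ⟨H', ⟨hH', hSH'⟩, rfl⟩
    rw [← ENat.add_le_add_iff_right hStop, hadd, encard_sdiff_add_encard_of_subset hSH']
    exact h.le_encard H' hH'
  · rintro _ ⟨H', ⟨hH', hSH'⟩, rfl⟩ I hI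
    have hd : Disjoint I S := disjoint_sdiff_left.mono_left hI
    rw [hind.contract_indep_iff, and_iff_right hd,
      h.indep_iff H' hH' _ (union_subset (hI.trans sdiff_subset) hSH'),
      encard_union_eq hd, ← hadd, ENat.add_lt_add_iff_right hStop]
  · intro I
    rw [hind.contract_indep_iff, (h.indep_relax hind).contract_indep_iff, h.relax_indep_iff,
      and_or_left]
    refine or_congr_right ?_
    constructor
    · rintro ⟨hd, H', hH', hIH', hc⟩
      refine ⟨_, ⟨H', ⟨hH', subset_union_right.trans hIH'⟩, rfl⟩,
        subset_sdiff.2 ⟨subset_union_left.trans hIH', hd⟩, ?_⟩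
      rw [encard_union_eq hd, ← hadd] at hc
      exact (ENat.add_left_injective_of_ne_top hStop) hc
    · rintro ⟨_, ⟨H', ⟨hH', hSH'⟩, rfl⟩, hIH, hc⟩
      have hd : Disjoint I S := disjoint_sdiff_left.mono_left hIH
      refine ⟨hd, H', hH', union_subset (hIH.trans sdiff_subset) hSH', ?_⟩
      rw [encard_union_eq hd, hc, hadd]

/-- Any `k - 1` elements of `S` are independent and already span `H`, so `S` is caught between them
and `H`. -/
theorem eRk_of_le_encard (h : IsRelaxation M M' F k) (hk : 1 ≤ k) (hH : H ∈ F) (hS : S ⊆ H)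
    (hc : (k : ℕ∞) ≤ S.encard) : rk M S + 1 = k ∧ M.closure S = H := by
  have h1 : ((k - 1 : ℕ) : ℕ∞) ≤ S.encard := le_trans (by exact_mod_cast Nat.sub_le k 1) hc
  obtain ⟨I, hI, hIc⟩ := exists_subset_encard_eq h1
  have hIc' : I.encard + 1 = k := by
    rw [hIc]
    exact_mod_cast Nat.sub_add_cancel hk
  have hcl := h.closure_eq hH (hI.trans hS) hIc'
  have hclS : M.closure S = H :=
    ((M.closure_subset_closure hS).trans (h.isFlat H hH).closure.subset).antisymm
      (hcl ▸ M.closure_subset_closure hI)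
  refine ⟨?_, hclS⟩
  have hind : M.Indep I := by
    rw [h.indep_iff H hH _ (hI.trans hS), hIc]
    exact_mod_cast Nat.sub_lt hk one_pos
  rw [rk, ← M.eRk_closure_eq, hclS, ← hcl, M.eRk_closure_eq, hind.eRk_eq_encard, hIc,
    ENat.toNat_natCast]
  omega

theorem rk_relax_of_le_encard (h : IsRelaxation M M' F k) (hH : H ∈ F) (hS : S ⊆ H)
    (hc : (k : ℕ∞) ≤ S.encard) : rk M' S = k := by
  obtain ⟨I, hI, hIc⟩ := exists_subset_encard_eq hc
  have hind : M'.Indep I := (h.relax_indep_iff I).2 (Or.inr ⟨H, hH, hI.trans hS, hIc⟩)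
  have h1 : M'.eRk S = k := by
    refine le_antisymm ?_ ?_
    · rw [← h.eRank_relax_eq]
      exact M'.eRk_le_eRank S
    · rw [← hIc, ← hind.eRk_eq_encard]
      exact M'.eRk_mono hI
  rw [rk, h1, ENat.toNat_natCast]

end IsRelaxation

end Relaxation

end EquivariantKL

namespace EquivariantKL

open Set

/-! ### Kazhdan-Lusztig polynomials in ranks zero and one -/

section SmallRank

variable {α : Type*} {M : Matroid α} {g : α → α}

/-- There is no degree below zero, so the correction has no terms. The value `1` occurs only for the
empty ground set. -/
theorem numKL_of_rank_zero (hf : M.E.Finite) (hne : M.E.Nonempty) (h : rank M = 0) :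
    numKL g M = 0 := by
  rw [numKL_eq g hf hne, h]
  simp [palindromicCorrection]

theorem image_sdiff_eq (hg : Function.Injective g) {E S : Set α} (hE : g '' E = E)
    (hS : g '' S = S) : g '' (E \ S) = E \ S := by
  rw [image_sdiff hg, hE, hS]

/-- By induction only the set of loops, when nonempty, and the ground set contribute to the
recursion. Its sum is `X` without loops and `1 + X` with loops, and the latter is already
palindromic. -/
theorem numKL_of_rank_one (hf : M.E.Finite) (hg : Function.Injective g) (hE : g '' M.E = M.E)
    (hL : g '' M.loops = M.loops) (h1 : rank M = 1) [Decidable (M.loops = ∅)] :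
    numKL g M = if M.loops = ∅ then 1 else 0 := by
  classical
  induction hn : M.E.ncard using Nat.strong_induction_on generalizing M with
  | _ n ih =>
  have hfin : M.Finite := ⟨hf⟩
  have hrkE : rk M M.E = 1 := by rw [rk, Matroid.eRk_ground, ← h1, rank]
  have hrk0 : ∀ S ⊆ M.loops, rk M S = 0 := fun S hS => by
    rw [rk, (Matroid.eRk_eq_zero_iff (hS.trans M.loops_subset_ground)).2 hS]
    rfl
  have hLE : M.loops ≠ M.E := fun h => by
    have := hrk0 _ h.symm.subset
    omega
  have hne : M.E.Nonempty := by
    rw [nonempty_iff_ne_empty]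
    intro h0
    exact hLE ((subset_empty_iff.1 (h0 ▸ M.loops_subset_ground)).trans h0.symm)
  have hterm : ∀ S ∈ fixedSubsets g M.E Set.Nonempty,
      (Polynomial.X : ℚ[X]) ^ rk M S * numKL g (M.contract S) =
        (if S = M.loops then 1 else 0) + (if S = M.E then Polynomial.X else 0) := by
    rintro S ⟨hSE, hgS, x, hx⟩
    have hadd := rank_contract_add M hSE
    by_cases hS : S ⊆ M.loops
    · have hcl : (M.contract S).loops = M.loops \ S := by
        rw [Matroid.contract_loops_eq, Matroid.closure_eq_loops_of_subset hS]
      have hSE' : S ≠ M.E := fun h => by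
        have := hrk0 S hS
        rw [h] at this
        omega
      rw [hrk0 S hS] at hadd ⊢
      rw [ih _ ?_ (hf.subset sdiff_subset) (image_sdiff_eq hg hE hgS) ?_ (by omega) rfl, hcl,
        if_neg hSE', pow_zero, one_mul, add_zero]
      · refine if_congr ?_ rfl rfl
        rw [sdiff_eq_empty]
        exact ⟨fun h => hS.antisymm h, fun h => h.symm.subset⟩
      · rw [← hn]
        exact ncard_lt_ncard ⟨sdiff_subset, fun h => (h (hSE hx)).2 hx⟩ hf
      · rw [hcl, image_sdiff_eq hg hL hgS]
    · have hrk : rk M S ≠ 0 := fun h => hS (by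
        rw [← Matroid.eRk_eq_zero_iff hSE]
        exact (ENat.toNat_eq_zero.1 h).resolve_right
          ((M.eRk_le_encard S).trans_lt (hf.subset hSE).encard_lt_top).ne)
      rw [if_neg fun h => hS h.subset, zero_add]
      split_ifs with hSE'
      · rw [numKL_of_empty g (M := M.contract S) (by simp [hSE']), mul_one,
          show rk M S = 1 by omega, pow_one]
      · rw [numKL_of_rank_zero (M := M.contract S) (hf.subset sdiff_subset) ?_ (by omega), mul_zero]
        rw [Matroid.contract_ground, sdiff_nonempty]
        exact fun h => hSE' (hSE.antisymm h)
  have hfs := finite_fixedSubsets g hf Set.Nonempty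
  have hEm : M.E ∈ hfs.toFinset := by
    rw [Finite.mem_toFinset]
    exact ⟨Subset.rfl, hE, hne⟩
  have hLm : M.loops ∈ hfs.toFinset ↔ M.loops ≠ ∅ := by
    rw [Finite.mem_toFinset, ← nonempty_iff_ne_empty]
    exact ⟨fun h => h.2.2, fun h => ⟨M.loops_subset_ground, hL, h⟩⟩
  rw [numKL_eq g hf hne, h1, numRest, finsum_mem_congr rfl hterm,
    finsum_mem_eq_finite_toFinset_sum _ hfs, Finset.sum_add_distrib, Finset.sum_ite_eq',
    Finset.sum_ite_eq', if_pos hEm]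
  ext n
  rw [coeff_palindromicCorrection]
  by_cases h0 : M.loops = ∅
  · rw [if_pos h0, if_neg fun h => hLm.1 h h0, zero_add]
    rcases n with _ | n
    · simp
    · rw [if_neg (by omega), Polynomial.coeff_one, if_neg (by omega)]
  · rw [if_neg h0, if_pos (hLm.2 h0)]
    rcases n with _ | n
    · simp [Polynomial.coeff_one]
    · rw [if_neg (by omega), Polynomial.coeff_zero]

end SmallRank

/-! ### Rearranging sums over pairs of a set and a hyperplane -/

section Sums

variable {α A : Type*} [AddCommMonoid A] {g : α → α}

theorem finsum_fixedSubsets_comm {E : Set α} (hE : E.Finite) {F : Set (Set α)}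
    (hF : ∀ H ∈ F, H ⊆ E) (p : Set α → Prop) (d : Set α → Set α → A) :
    ∑ᶠ S ∈ fixedSubsets g E p, ∑ᶠ H ∈ {H | H ∈ F ∧ g '' H = H ∧ S ⊆ H}, d S H =
      ∑ᶠ H ∈ {H | H ∈ F ∧ g '' H = H}, ∑ᶠ S ∈ fixedSubsets g H p, d S H := by
  classical
  have hfs := finite_fixedSubsets g hE p
  have hfF : {H | H ∈ F ∧ g '' H = H}.Finite :=
    hE.finite_subsets.subset fun H hH => hF H hH.1
  have h1 : ∀ S, {H | H ∈ F ∧ g '' H = H ∧ S ⊆ H} =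
      ((hfF.toFinset.filter (S ⊆ ·) : Finset (Set α)) : Set (Set α)) := fun S => by
    ext H
    simp [and_assoc]
  have h2 : ∀ H ∈ hfF.toFinset, fixedSubsets g H p =
      ((hfs.toFinset.filter (· ⊆ H) : Finset (Set α)) : Set (Set α)) := fun H hH => by
    ext S
    have := hF H (hfF.mem_toFinset.1 hH).1
    simp only [fixedSubsets, Finset.coe_filter, Finite.mem_toFinset, mem_ofPred_eq]
    exact ⟨fun h => ⟨⟨h.1.trans this, h.2⟩, h.1⟩, fun h => ⟨h.2, h.1.2⟩⟩
  rw [finsum_mem_eq_finite_toFinset_sum _ hfs, finsum_mem_eq_finite_toFinset_sum _ hfF]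
  simp only [h1, finsum_mem_coe_finset]
  have h3 : ∑ H ∈ hfF.toFinset, ∑ᶠ S ∈ fixedSubsets g H p, d S H =
      ∑ H ∈ hfF.toFinset, ∑ S ∈ hfs.toFinset.filter (· ⊆ H), d S H :=
    Finset.sum_congr rfl fun H hH => by rw [h2 H hH, finsum_mem_coe_finset]
  rw [h3]
  simp only [Finset.sum_filter]
  exact Finset.sum_comm

theorem finsum_fixedSubsets_ite {H : Set α} (hH : H.Finite) (hg : g '' H = H) {k : ℕ}
    (hk : (k : ℕ∞) ≤ H.encard) {p : Set α → Prop} (hp : p H) (a : Set α → A) (b : A)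
    [∀ S : Set α, Decidable (S.encard < k)] [∀ S : Set α, Decidable (S = H)] :
    ∑ᶠ S ∈ fixedSubsets g H p, (if S.encard < k then a S else if S = H then b else 0) =
      (∑ᶠ S ∈ fixedSubsets g H (fun S => p S ∧ S.encard < k), a S) + b := by
  have hfs := finite_fixedSubsets g hH p
  have h1 : fixedSubsets g H (fun S => p S ∧ S.encard < k) =
      ((hfs.toFinset.filter (fun S => S.encard < k) : Finset (Set α)) : Set (Set α)) := by
    ext S
    simp [fixedSubsets, and_assoc]
  rw [h1, finsum_mem_coe_finset, finsum_mem_eq_finite_toFinset_sum _ hfs, Finset.sum_ite]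
  congr 1
  rw [Finset.sum_eq_single H (fun S _ hS => if_neg hS), if_pos rfl]
  refine fun h => absurd ?_ h
  rw [Finset.mem_filter, hfs.mem_toFinset]
  exact ⟨⟨Subset.rfl, hg, hp⟩, not_lt.2 hk⟩

theorem finsum_sdiff_image (hg : Function.Injective g) {F : Set (Set α)} {S : Set α}
    (hS : g '' S = S) (φ : Set α → A) :
    ∑ᶠ H ∈ {H | H ∈ (· \ S) '' {H' | H' ∈ F ∧ S ⊆ H'} ∧ g '' H = H}, φ H =
      ∑ᶠ H ∈ {H | H ∈ F ∧ g '' H = H ∧ S ⊆ H}, φ (H \ S) := by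
  refine (finsum_mem_eq_of_bijOn (· \ S) ⟨?_, ?_, ?_⟩ fun H _ => rfl).symm
  · rintro H ⟨hH, hgH, hSH⟩
    exact ⟨⟨H, ⟨hH, hSH⟩, rfl⟩, image_sdiff_eq hg hgH hS⟩
  · rintro H ⟨-, -, hH⟩ H' ⟨-, -, hH'⟩ h
    have h' : H \ S = H' \ S := h
    rw [← sdiff_union_of_subset hH, h', sdiff_union_of_subset hH']
  · rintro _ ⟨⟨H, ⟨hH, hSH⟩, rfl⟩, hgH⟩
    refine ⟨H, ⟨hH, ?_, hSH⟩, rfl⟩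
    have h' : g '' (H \ S) = H \ S := hgH
    rw [← sdiff_union_of_subset hSH, image_union, h', hS]

end Sums

/-! ### The change of the numerical polynomials under relaxation -/

namespace IsRelaxation

variable {α : Type*} {M M' : Matroid α} {F : Set (Set α)} {k : ℕ} {H S : Set α} {g : α → α}

/-- The hyperplane has rank `k - 1`, so it cannot be the ground set. This excludes the exceptional
value `1` for contractions of rank zero. -/
theorem nonempty_sdiff_of_subset (h : IsRelaxation M M' F k) (hk : 1 ≤ k) (hH : H ∈ F)
    (hS : S ⊆ H) : (M.E \ S).Nonempty := by
  rw [sdiff_nonempty]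
  intro hE
  have hHE := (h.subset_ground hH).antisymm (hE.trans hS)
  have h1 : (k : ℕ∞) ≤ H.encard := h.le_encard H hH
  have h2 := (h.eRk_of_le_encard hk hH Subset.rfl h1).1
  rw [hHE, rk, Matroid.eRk_ground, h.eRank_eq, ENat.toNat_natCast] at h2
  omega

/-- A member of `F` containing so large a set is unique. Since `g '' H` also contains `S`, the
hyperplane is fixed. -/
theorem setOf_fixed_superset_eq (h : IsRelaxation M M' F k) (hk : 1 ≤ k)
    (hF : ∀ H ∈ F, g '' H ∈ F) (hH : H ∈ F) (hS : S ⊆ H) (hgS : g '' S = S)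
    (hc : (k : ℕ∞) ≤ S.encard) : {H' | H' ∈ F ∧ g '' H' = H' ∧ S ⊆ H'} = {H} := by
  have hc' : (k : ℕ∞) ≤ S.encard + 1 := hc.trans le_self_add
  ext H'
  rw [mem_singleton_iff]
  constructor
  · rintro ⟨hH', -, hS'⟩
    exact h.eq_of_subset hk hH' hH hS' hS hc'
  · rintro rfl
    refine ⟨hH, h.eq_of_subset hk (hF _ hH) hH ?_ hS hc', hS⟩
    rw [← hgS]
    exact image_mono hS

theorem numKL_relax_contract (h : IsRelaxation M M' F k) (hk : 1 ≤ k) (hH : H ∈ F) (hS : S ⊆ H)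
    (hc : (k : ℕ∞) ≤ S.encard) : numKL g (M'.contract S) = 0 := by
  have hSE : S ⊆ M'.E := h.ground_eq ▸ hS.trans (h.subset_ground hH)
  have : M'.Finite := ⟨h.ground_eq ▸ h.finite⟩
  have h1 := rank_contract_add M' hSE
  rw [h.rank_relax_eq, h.rk_relax_of_le_encard hH hS hc] at h1
  refine numKL_of_rank_zero (M'.ground_finite.subset sdiff_subset) ?_ (by omega)
  rw [Matroid.contract_ground, h.ground_eq]
  exact h.nonempty_sdiff_of_subset hk hH hS

/-- Since `S` spans `H`, the contraction has rank one and its loops are `H \ S`, which is empty only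
for `S = H`. -/
theorem numKL_contract (h : IsRelaxation M M' F k) (hk : 1 ≤ k) (hg : Function.Injective g)
    (hE : g '' M.E = M.E) (hF : ∀ H ∈ F, g '' H ∈ F) (hH : H ∈ F) (hS : S ⊆ H) (hgS : g '' S = S)
    (hc : (k : ℕ∞) ≤ S.encard) [Decidable (S = H)] :
    numKL g (M.contract S) = if S = H then 1 else 0 := by
  classical
  have hSE : S ⊆ M.E := hS.trans (h.subset_ground hH)
  have : M.Finite := ⟨h.finite⟩
  have h1 := rank_contract_add M hSE
  obtain ⟨h2, hcl⟩ := h.eRk_of_le_encard hk hH hS hc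
  rw [h.rank_eq] at h1
  have hgH : g '' H = H := by
    have : H ∈ {H' | H' ∈ F ∧ g '' H' = H' ∧ S ⊆ H'} := by
      rw [h.setOf_fixed_superset_eq hk hF hH hS hgS hc]
      rfl
    exact this.2.1
  have hL : (M.contract S).loops = H \ S := by rw [Matroid.contract_loops_eq, hcl]
  rw [numKL_of_rank_one (h.finite.subset sdiff_subset) hg (image_sdiff_eq hg hE hgS)
    (by rw [hL, image_sdiff_eq hg hgH hgS]) (by omega), hL]
  refine if_congr ?_ rfl rfl
  rw [sdiff_eq_empty]
  exact ⟨fun h => hS.antisymm h, fun h => h.symm.subset⟩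

theorem setOf_superset_eq_empty (hS : ∀ H ∈ F, ¬ S ⊆ H) :
    {H | H ∈ F ∧ g '' H = H ∧ S ⊆ H} = ∅ :=
  eq_empty_of_forall_notMem fun H hH => hS H hH.1 hH.2.2

theorem finite_setOf_superset (h : IsRelaxation M M' F k) :
    {H | H ∈ F ∧ g '' H = H ∧ S ⊆ H}.Finite :=
  h.finite.finite_subsets.subset fun _ hH => h.subset_ground hH.1

/-- The formula for contractions by nonempty small sets is a hypothesis, supplied first by the
induction in `numKL_sub` and then, for `Z`, by its result. -/
theorem numRest_sub_of_contract (h : IsRelaxation M M' F k) (hk : 1 ≤ k)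
    (hg : Function.Injective g) (hE : g '' M.E = M.E) (hF : ∀ H ∈ F, g '' H ∈ F)
    (ih : ∀ H ∈ F, ∀ S ⊆ H, g '' S = S → S.Nonempty → S.encard < k →
      numKL g (M'.contract S) - numKL g (M.contract S) =
        ∑ᶠ H' ∈ {H' | H' ∈ F ∧ g '' H' = H' ∧ S ⊆ H'}, relKL g (k - S.ncard) (H' \ S)) :
    numRest g M' - numRest g M = ∑ᶠ H ∈ {H | H ∈ F ∧ g '' H = H}, relRest g k H := by
  classical
  have hfs := finite_fixedSubsets g h.finite Set.Nonempty
  rw [numRest, numRest, h.ground_eq, ← finsum_mem_sub_distrib _ _ hfs]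
  -- The share of `H` in the change of the summand of `S`. A small `S` may lie in several
  -- hyperplanes; a large one lies in only one and matters only when equal to it.
  let d : Set α → Set α → ℚ[X] := fun S H => if S.encard < k then
    Polynomial.X ^ S.ncard * relKL g (k - S.ncard) (H \ S) else
      if S = H then -Polynomial.X ^ (k - 1) else 0
  have hterm : ∀ S ∈ fixedSubsets g M.E Set.Nonempty,
      Polynomial.X ^ rk M' S * numKL g (M'.contract S) -
        Polynomial.X ^ rk M S * numKL g (M.contract S) =
      ∑ᶠ H ∈ {H | H ∈ F ∧ g '' H = H ∧ S ⊆ H}, d S H := by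
    rintro S ⟨hSE, hgS, hne⟩
    by_cases hS : ∀ H ∈ F, ¬ S ⊆ H
    · rw [setOf_superset_eq_empty hS, finsum_mem_empty, h.rk_eq_of_forall_not_subset hS hSE,
        h.contract_eq_of_forall_not_subset hS hSE, sub_self]
    · push Not at hS
      obtain ⟨H, hH, hSH⟩ := hS
      by_cases hlt : S.encard < k
      · rw [h.rk_of_subset hH hSH hlt, h.rk_relax_of_subset hH hSH hlt, ← mul_sub,
          ih H hH S hSH hgS hne hlt, mul_finsum_mem' _ _ h.finite_setOf_superset]
        exact finsum_mem_congr rfl fun H' _ => (if_pos hlt).symm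
      · have hc := not_lt.1 hlt
        rw [h.setOf_fixed_superset_eq hk hF hH hSH hgS hc, finsum_mem_singleton,
          h.numKL_relax_contract hk hH hSH hc, h.numKL_contract hk hg hE hF hH hSH hgS hc]
        have := (h.eRk_of_le_encard hk hH hSH hc).1
        simp only [d, if_neg hlt, show rk M S = k - 1 by omega]
        split_ifs <;> simp
  -- Exchanging the sums collects, for each fixed hyperplane, the contributions of its fixed
  -- subsets, which add up to `relRest`.
  rw [finsum_mem_congr rfl hterm,
    finsum_fixedSubsets_comm h.finite (fun H hH => h.subset_ground hH)]
  refine finsum_mem_congr rfl ?_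
  rintro H ⟨hH, hgH⟩
  have hHf := h.finite.subset (h.subset_ground hH)
  have hHne : H.Nonempty := by
    rw [← encard_ne_zero, ← Order.one_le_iff_ne_zero]
    exact le_trans (by exact_mod_cast hk) (h.le_encard H hH)
  simp only [d]
  rw [finsum_fixedSubsets_ite hHf hgH (h.le_encard H hH) hHne, relRest, sub_eq_add_neg]

/-- The change of the Kazhdan-Lusztig polynomial under relaxation. -/
theorem numKL_sub (h : IsRelaxation M M' F k) (hk : 1 ≤ k) (hg : Function.Injective g)
    (hE : g '' M.E = M.E) (hF : ∀ H ∈ F, g '' H ∈ F) :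
    numKL g M' - numKL g M = ∑ᶠ H ∈ {H | H ∈ F ∧ g '' H = H}, relKL g k H := by
  induction k using Nat.strong_induction_on generalizing M M' F with
  | _ k ih =>
  have hne : M.E.Nonempty := by
    rw [nonempty_iff_ne_empty]
    intro h0
    have := M.eRk_le_encard M.E
    rw [Matroid.eRk_ground, h.eRank_eq, h0, encard_empty] at this
    exact absurd (by exact_mod_cast this : k ≤ 0) (by omega)
  have hrest := h.numRest_sub_of_contract hk hg hE hF fun H hH S hS hgS hSne hlt => by
    have hSf : S.Finite := encard_lt_top_iff.1 (hlt.trans (ENat.natCast_lt_top k))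
    have hlt' : S.ncard < k := by rwa [← hSf.cast_ncard_eq, Nat.cast_lt] at hlt
    have hpos := (ncard_pos hSf).2 hSne
    rw [ih (k - S.ncard) (by omega) (h.contract hH hS hlt) (by omega)
      (image_sdiff_eq hg hE hgS) ?_, finsum_sdiff_image hg hgS]
    rintro _ ⟨H', ⟨hH', hSH'⟩, rfl⟩
    refine ⟨g '' H', ⟨hF _ hH', ?_⟩, ?_⟩
    · rw [← hgS]
      exact image_mono hSH'
    · change _ = g '' (H' \ S)
      rw [image_sdiff hg, hgS]
  have hfF : {H | H ∈ F ∧ g '' H = H}.Finite :=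
    h.finite.finite_subsets.subset fun H hH => h.subset_ground hH.1
  rw [numKL_eq g (h.ground_eq ▸ h.finite) (h.ground_eq ▸ hne), numKL_eq g h.finite hne,
    h.rank_eq, h.rank_relax_eq]
  -- The correction is linear and the rank is unchanged, so it turns the change of the sum into the
  -- change of `P`.
  have hcorr : palindromicCorrection k (numRest g M') - palindromicCorrection k (numRest g M) =
      palindromicCorrection k (numRest g M' - numRest g M) := by
    ext n
    simp only [Polynomial.coeff_sub, coeff_palindromicCorrection]
    split_ifs <;> ring
  rw [hcorr, hrest, finsum_mem_eq_finite_toFinset_sum _ hfF,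
    finsum_mem_eq_finite_toFinset_sum _ hfF]
  ext n
  simp only [coeff_palindromicCorrection, Polynomial.finsetSum_coeff, relKL_eq]
  split_ifs
  · rw [Finset.sum_sub_distrib]
  · rw [Finset.sum_const_zero]

theorem numKL_contract_sub (h : IsRelaxation M M' F k) (hg : Function.Injective g)
    (hE : g '' M.E = M.E) (hF : ∀ H ∈ F, g '' H ∈ F) (hH : H ∈ F) (hS : S ⊆ H) (hgS : g '' S = S)
    (hlt : S.encard < k) :
    numKL g (M'.contract S) - numKL g (M.contract S) =
      ∑ᶠ H' ∈ {H' | H' ∈ F ∧ g '' H' = H' ∧ S ⊆ H'}, relKL g (k - S.ncard) (H' \ S) := by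
  have hSf : S.Finite := encard_lt_top_iff.1 (hlt.trans (ENat.natCast_lt_top k))
  have hlt' : S.ncard < k := by rwa [← hSf.cast_ncard_eq, Nat.cast_lt] at hlt
  rw [(h.contract hH hS hlt).numKL_sub (by omega) hg (image_sdiff_eq hg hE hgS) ?_,
    finsum_sdiff_image hg hgS]
  rintro _ ⟨H', ⟨hH', hSH'⟩, rfl⟩
  refine ⟨g '' H', ⟨hF _ hH', ?_⟩, ?_⟩
  · rw [← hgS]
    exact image_mono hSH'
  · change _ = g '' (H' \ S)
    rw [image_sdiff hg, hgS]

/-- The change of the `Z`-polynomial under relaxation. -/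
theorem numZ_sub (h : IsRelaxation M M' F k) (hk : 1 ≤ k) (hg : Function.Injective g)
    (hE : g '' M.E = M.E) (hF : ∀ H ∈ F, g '' H ∈ F) :
    numZ g M' - numZ g M =
      ∑ᶠ H ∈ {H | H ∈ F ∧ g '' H = H}, (relKL g k H + relRest g k H) := by
  have hfF : {H | H ∈ F ∧ g '' H = H}.Finite :=
    h.finite.finite_subsets.subset fun H hH => h.subset_ground hH.1
  rw [finsum_mem_add_distrib hfF, ← h.numKL_sub hk hg hE hF, ← h.numRest_sub_of_contract hk hg hE hF
    fun H hH S hS hgS _ hlt => h.numKL_contract_sub hg hE hF hH hS hgS hlt, numZ, numZ]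
  ring

/-- The change of the inverse Kazhdan-Lusztig polynomial under relaxation. -/
theorem numInv_sub (h : IsRelaxation M M' F k) (hk : 1 ≤ k) (hg : Function.Injective g)
    (hE : g '' M.E = M.E) (hF : ∀ H ∈ F, g '' H ∈ F) :
    numInv g M' - numInv g M =
      ∑ᶠ H ∈ {H | H ∈ F ∧ g '' H = H}, relInv g k (M.restrict H) := by
  classical
  have hne : M.E.Nonempty := by
    rw [nonempty_iff_ne_empty]
    intro h0
    have := M.eRk_le_encard M.E
    rw [Matroid.eRk_ground, h.eRank_eq, h0, encard_empty] at this
    exact absurd (by exact_mod_cast this : k ≤ 0) (by omega)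
  have hfs := finite_fixedSubsets g h.finite (· ≠ M.E)
  have hfF : {H | H ∈ F ∧ g '' H = H}.Finite :=
    h.finite.finite_subsets.subset fun H hH => h.subset_ground hH.1
  let d : Set α → Set α → ℚ[X] := fun S H => if S.encard < k then
    (-1) ^ S.ncard * (numInv g (M.restrict S) * relKL g (k - S.ncard) (H \ S)) else
      if S = H then -((-1) ^ (k - 1) * numInv g (M.restrict H)) else 0
  have hterm : ∀ S ∈ fixedSubsets g M.E (· ≠ M.E),
      (-1) ^ rk M' S * (numInv g (M'.restrict S) * numKL g (M'.contract S)) -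
        (-1) ^ rk M S * (numInv g (M.restrict S) * numKL g (M.contract S)) =
      ∑ᶠ H ∈ {H | H ∈ F ∧ g '' H = H ∧ S ⊆ H}, d S H := by
    rintro S ⟨hSE, hgS, hSne⟩
    by_cases hS : ∀ H ∈ F, ¬ S ⊆ H
    · rw [setOf_superset_eq_empty hS, finsum_mem_empty, h.rk_eq_of_forall_not_subset hS hSE,
        h.contract_eq_of_forall_not_subset hS hSE]
      -- For a proper subset of full rank the restriction may change, but the contraction, equal in
      -- both matroids, has rank zero and nonempty ground set, so both summands vanish.
      by_cases hlt : rk M S < k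
      · rw [h.restrict_eq_of_forall_not_subset hk hS hSE hlt, sub_self]
      · have : M.Finite := ⟨h.finite⟩
        have hadd := rank_contract_add M hSE
        rw [h.rank_eq] at hadd
        rw [numKL_of_rank_zero (M := M.contract S) (h.finite.subset sdiff_subset) ?_ (by omega)]
        · simp
        · rw [Matroid.contract_ground, sdiff_nonempty]
          exact fun h' => hSne (hSE.antisymm h')
    · push Not at hS
      obtain ⟨H, hH, hSH⟩ := hS
      by_cases hlt : S.encard < k
      · rw [h.rk_of_subset hH hSH hlt, h.rk_relax_of_subset hH hSH hlt,
          h.restrict_eq_of_subset hH hSH hlt, ← mul_sub, ← mul_sub,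
          h.numKL_contract_sub hg hE hF hH hSH hgS hlt,
          mul_finsum_mem' _ _ h.finite_setOf_superset, mul_finsum_mem' _ _ h.finite_setOf_superset]
        exact finsum_mem_congr rfl fun H' _ => (if_pos hlt).symm
      · have hc := not_lt.1 hlt
        rw [h.setOf_fixed_superset_eq hk hF hH hSH hgS hc, finsum_mem_singleton,
          h.numKL_relax_contract hk hH hSH hc, h.numKL_contract hk hg hE hF hH hSH hgS hc]
        have := (h.eRk_of_le_encard hk hH hSH hc).1
        simp only [d, if_neg hlt, show rk M S = k - 1 by omega]
        split_ifs with hSH'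
        · simp [hSH']
        · simp
  have hsum : (∑ᶠ S ∈ fixedSubsets g M.E (· ≠ M.E),
      (-1) ^ rk M' S * (numInv g (M'.restrict S) * numKL g (M'.contract S))) -
      (∑ᶠ S ∈ fixedSubsets g M.E (· ≠ M.E),
        (-1) ^ rk M S * (numInv g (M.restrict S) * numKL g (M.contract S))) =
      ∑ᶠ H ∈ {H | H ∈ F ∧ g '' H = H}, ((∑ᶠ S ∈ fixedSubsets g H (fun S => S.encard < k),
        (-1) ^ S.ncard * (numInv g (M.restrict S) * relKL g (k - S.ncard) (H \ S))) -
        (-1) ^ (k - 1) * numInv g (M.restrict H)) := by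
    rw [← finsum_mem_sub_distrib _ _ hfs, finsum_mem_congr rfl hterm,
      finsum_fixedSubsets_comm h.finite (fun H hH => h.subset_ground hH)]
    refine finsum_mem_congr rfl ?_
    rintro H ⟨hH, hgH⟩
    have hHf := h.finite.subset (h.subset_ground hH)
    have hHE : ∀ S ⊆ H, S ≠ M.E := fun S hS h' => by
      have := h.nonempty_sdiff_of_subset hk hH hS
      rw [h', sdiff_self] at this
      exact not_nonempty_empty this
    simp only [d]
    rw [finsum_fixedSubsets_ite hHf hgH (h.le_encard H hH) (hHE H Subset.rfl), sub_eq_add_neg]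
    congr 1
    refine finsum_mem_congr ?_ fun _ _ => rfl
    ext S
    exact ⟨fun hS => ⟨hS.1, hS.2.1, hS.2.2.2⟩, fun hS => ⟨hS.1, hS.2.1, hHE S hS.1, hS.2.2⟩⟩
  rw [numInv_eq g (h.ground_eq ▸ h.finite) (h.ground_eq ▸ hne), numInv_eq g h.finite hne,
    h.rank_eq, h.rank_relax_eq, h.ground_eq, ← neg_sub_neg, neg_neg, neg_neg, ← mul_sub,
    ← neg_sub, mul_neg, hsum, mul_finsum_mem' _ _ hfF, ← finsum_mem_neg_distrib _ hfF]
  refine finsum_mem_congr rfl ?_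
  rintro H ⟨hH, -⟩
  rw [relInv, Matroid.restrict_ground_eq]
  congr 3
  refine finsum_mem_congr rfl fun S hS => ?_
  rw [Matroid.restrict_restrict_eq _ hS.1]

end IsRelaxation

end EquivariantKL

namespace EquivariantKL

open Set

/-! ### Relaxing the orbit of a stressed hyperplane -/

section Orbit

variable {α : Type*} {M : Matroid α} [M.Finite] {F : Set (Set α)} {k : ℕ}

theorem eRank_eq_of_rank_eq (hk : rank M = k) : M.eRank = k := by
  have h : M.eRank ≠ ⊤ := by
    rw [Matroid.eRank_ne_top_iff]
    infer_instance
  rw [← ENat.natCast_toNat h]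
  exact congrArg _ hk

/-- In a stressed hyperplane a set with at least `k` elements contains a circuit. A smaller set is a
proper subset of a `k`-element circuit, and for this the hyperplane must have at least `k` elements.
-/
theorem isRelaxation_relax (hF : ∀ H ∈ F, IsStressedHyperplane M H) (hk : rank M = k)
    (hle : ∀ H ∈ F, (k : ℕ∞) ≤ H.encard) : IsRelaxation M (relax M F hF) F k := by
  have hr := eRank_eq_of_rank_eq hk
  have hind : ∀ H ∈ F, ∀ I ⊆ H, M.Indep I ↔ I.encard < k := by
    intro H hH I hI
    constructor
    · intro h
      by_contra! hc
      obtain ⟨C, hC, hCk⟩ := exists_subset_encard_eq hc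
      exact ((hF H hH).2 C (hC.trans hI) (hCk.trans hr.symm)).dep.not_indep (h.subset hC)
    · intro h
      obtain ⟨C, hIC, hC, hCk⟩ := exists_superset_subset_encard_eq hI h.le (hle H hH)
      refine ((hF H hH).2 C hC (hCk.trans hr.symm)).ssubset_indep (hIC.ssubset_of_ne ?_)
      rintro rfl
      exact h.ne hCk
  refine ⟨M.ground_finite, rfl, hr, fun H hH => (hF H hH).1.prop.1, hle, hind, fun I => ?_⟩
  rw [Matroid.indep_iff]
  constructor
  · rintro ⟨B, hB | ⟨H, hH, hBH, hB⟩, hIB⟩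
    · exact Or.inl (hB.indep.subset hIB)
    · rw [hr] at hB
      rcases (encard_le_encard hIB).lt_or_eq with h | h
      · exact Or.inl ((hind H hH I (hIB.trans hBH)).2 (hB ▸ h))
      · exact Or.inr ⟨H, hH, hIB.trans hBH, h.trans hB⟩
  · rintro (hI | ⟨H, hH, hIH, hI⟩)
    · obtain ⟨B, hB, hIB⟩ := hI.exists_isBase_superset
      exact ⟨B, Or.inl hB, hIB⟩
    · exact ⟨I, Or.inr ⟨H, hH, hIH, hI.trans hr.symm⟩, Subset.rfl⟩

variable {W : Type} [Group W] [MulAction W α] {H : Set α}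

theorem IsSymmetric.relax_orbit (hW : IsSymmetric W M) (hH : IsStressedHyperplane M H) :
    IsSymmetric W (relax M (MulAction.orbit W H) (hW.isStressedHyperplane_of_mem_orbit hH)) := by
  refine fun w => ⟨(hW w).1, ?_⟩
  rintro B (hB | ⟨J, hJ, hBJ, hB⟩)
  · exact Or.inl ((hW w).2 B hB)
  · exact Or.inr ⟨w • J, MulAction.mem_orbit_of_mem_orbit w hJ, smul_set_mono hBJ,
      ((MulAction.injective w).encard_image B).trans hB⟩

theorem isRelaxation_relax_orbit (hW : IsSymmetric W M) (hH : IsStressedHyperplane M H)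
    (hk : rank M = k) (hle : (k : ℕ∞) ≤ H.encard) :
    IsRelaxation M (relax M (MulAction.orbit W H) (hW.isStressedHyperplane_of_mem_orbit hH))
      (MulAction.orbit W H) k := by
  refine isRelaxation_relax _ hk ?_
  rintro _ ⟨w, rfl⟩
  exact hle.trans ((MulAction.injective w).encard_image H).ge

variable [Finite W]

theorem charPoly_klPoly_relax (hW : IsSymmetric W M) (hH : IsStressedHyperplane M H) (hk1 : 1 ≤ k)
    (hk : rank M = k) (hle : (k : ℕ∞) ≤ H.encard) (w : W) :
    charPoly w (klPoly W (relax M (MulAction.orbit W H)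
      (hW.isStressedHyperplane_of_mem_orbit hH)) - klPoly W M) =
      ∑ᶠ J ∈ {J | J ∈ MulAction.orbit W H ∧ w • J = J}, relKL (w • ·) k J := by
  rw [map_sub, charPoly_klPoly (hW.relax_orbit hH), charPoly_klPoly hW]
  exact (isRelaxation_relax_orbit hW hH hk hle).numKL_sub hk1 (MulAction.injective w) (hW w).1
    fun J hJ => MulAction.mem_orbit_of_mem_orbit w hJ

theorem charPoly_zPoly_relax (hW : IsSymmetric W M) (hH : IsStressedHyperplane M H) (hk1 : 1 ≤ k)
    (hk : rank M = k) (hle : (k : ℕ∞) ≤ H.encard) (w : W) :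
    charPoly w (zPoly W (relax M (MulAction.orbit W H)
      (hW.isStressedHyperplane_of_mem_orbit hH)) - zPoly W M) =
      ∑ᶠ J ∈ {J | J ∈ MulAction.orbit W H ∧ w • J = J},
        (relKL (w • ·) k J + relRest (w • ·) k J) := by
  rw [map_sub, charPoly_zPoly (hW.relax_orbit hH), charPoly_zPoly hW]
  exact (isRelaxation_relax_orbit hW hH hk hle).numZ_sub hk1 (MulAction.injective w) (hW w).1
    fun J hJ => MulAction.mem_orbit_of_mem_orbit w hJ

theorem charPoly_invKlPoly_relax (hW : IsSymmetric W M) (hH : IsStressedHyperplane M H)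
    (hk1 : 1 ≤ k) (hk : rank M = k) (hle : (k : ℕ∞) ≤ H.encard) (w : W) :
    charPoly w (invKlPoly W (relax M (MulAction.orbit W H)
      (hW.isStressedHyperplane_of_mem_orbit hH)) - invKlPoly W M) =
      ∑ᶠ J ∈ {J | J ∈ MulAction.orbit W H ∧ w • J = J}, relInv (w • ·) k (M.restrict J) := by
  rw [map_sub, charPoly_invKlPoly (hW.relax_orbit hH), charPoly_invKlPoly hW]
  exact (isRelaxation_relax_orbit hW hH hk hle).numInv_sub hk1 (MulAction.injective w) (hW w).1
    fun J hJ => MulAction.mem_orbit_of_mem_orbit w hJ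

theorem charPoly_indRes {h : ℕ} (e : H ≃ Fin h) (f : (VRep (Equiv.Perm (Fin h)))[X])
    (c : Set α → W → ℚ[X])
    (hf : ∀ u : MulAction.stabilizer W H, charPoly (stabToPerm H e u) f = c H u)
    (hc : ∀ x g : W, g • H = H → c (x • H) (x * g * x⁻¹) = c H g) (w : W) :
    charPoly w (indRes H e f) =
      ∑ᶠ J ∈ {J | J ∈ MulAction.orbit W H ∧ w • J = J}, c J w := by
  refine charPoly_indStab H _ c (fun u => ?_) hc w
  rw [← hf u]
  ext n
  rw [coeff_charPoly, coeff_charPoly, coeff_mapCoeff, VRep.charHom_res]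

end Orbit

/-! ### The model example, invariant under the whole symmetric group -/

section Model

/-- The direct sum of a coloop and the uniform matroid of rank `k - 1` on `h` elements. -/
noncomputable def coloopSumUniform (k h : ℕ) (hk : 1 ≤ k) (hkh : k ≤ h) :
    Matroid (Option (Fin h)) :=
  Matroid.ofIsBaseOfFinite (E := univ) finite_univ (fun B => none ∈ B ∧ B.encard = k)
    (by
      obtain ⟨B, hB, -, hBk⟩ := exists_superset_subset_encard_eq (subset_univ {(none : Option (Fin h))})
        (k := k) (by rw [encard_singleton]; exact_mod_cast hk)
        (by
          rw [encard_univ, ENat.card_eq_coe_fintype_card, Fintype.card_option, Fintype.card_fin]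
          exact_mod_cast hkh.trans (Nat.le_succ h))
      exact ⟨B, hB rfl, hBk⟩)
    (by
      rintro B₁ B₂ ⟨h₁, hc₁⟩ ⟨h₂, hc₂⟩ x hx
      obtain ⟨y, hy⟩ : (B₂ \ B₁).Nonempty := by
        rw [sdiff_nonempty]
        intro h'
        have := (toFinite B₁).eq_of_subset_of_encard_le' h' (by rw [hc₁, hc₂])
        exact hx.2 (this ▸ hx.1)
      refine ⟨y, hy, mem_insert_of_mem _ ⟨h₁, fun h' => hx.2 (h' ▸ h₂)⟩, ?_⟩
      rw [encard_insert_of_notMem fun h' => hy.2 h'.1, encard_sdiff_singleton_add_one hx.1, hc₁])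
    (fun _ _ => subset_univ _)

variable {k h : ℕ} {hk : 1 ≤ k} {hkh : k ≤ h}

instance : (coloopSumUniform k h hk hkh).Finite := ⟨finite_univ⟩

theorem coloopSumUniform_eRank : (coloopSumUniform k h hk hkh).eRank = k := by
  obtain ⟨B, hB⟩ := (coloopSumUniform k h hk hkh).exists_isBase
  rw [← hB.encard_eq_eRank]
  exact hB.2

theorem coloopSumUniform_indep_insert_none {I : Set (Option (Fin h))}
    (hI : (coloopSumUniform k h hk hkh).Indep I) :
    (coloopSumUniform k h hk hkh).Indep (insert none I) := by
  obtain ⟨B, hB, hIB⟩ := hI.exists_isBase_superset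
  exact hB.indep.subset (insert_subset hB.1 hIB)

theorem encard_range_some : (range (some : Fin h → Option (Fin h))).encard = h := by
  rw [← image_univ, (Option.some_injective _).encard_image, encard_univ,
    ENat.card_eq_coe_fintype_card, Fintype.card_fin]

/-- Bases are the `k`-element sets containing `none`; a set without `none` extends to one exactly
when there is room for `none`. -/
theorem coloopSumUniform_indep_iff {I : Set (Option (Fin h))} (hI : I ⊆ range some) :
    (coloopSumUniform k h hk hkh).Indep I ↔ I.encard < k := by
  have hn : none ∉ I := fun h' => by
    obtain ⟨x, hx⟩ := hI h'
    exact Option.some_ne_none x hx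
  have hfin : I.encard ≠ ⊤ := (toFinite I).encard_lt_top.ne
  rw [← ENat.add_one_le_iff hfin, ← encard_insert_of_notMem hn]
  constructor
  · intro h'
    rw [← coloopSumUniform_eRank (hk := hk) (hkh := hkh)]
    exact (coloopSumUniform_indep_insert_none h').encard_le_eRank
  · intro h'
    obtain ⟨B, hIB, -, hB⟩ := exists_superset_subset_encard_eq (subset_univ (insert none I)) h' (by
      rw [encard_univ, ENat.card_eq_coe_fintype_card, Fintype.card_option, Fintype.card_fin]
      exact_mod_cast hkh.trans (Nat.le_succ h))
    have hBase : (coloopSumUniform k h hk hkh).IsBase B := ⟨hIB (mem_insert _ _), hB⟩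
    exact hBase.indep.subset ((subset_insert _ _).trans hIB)

/-- The coloop `none` can be added to every independent set, so it is not in the closure of `range
some`; as it is the only other element, this flat is a hyperplane. -/
theorem coloopSumUniform_isStressedHyperplane :
    IsStressedHyperplane (coloopSumUniform k h hk hkh) (range some) := by
  have huniv : ∀ J : Set (Option (Fin h)), none ∈ J → range some ⊆ J → J = univ := by
    refine fun J hn hJ => eq_univ_of_forall fun x => ?_
    cases x with
    | none => exact hn
    | some x => exact hJ ⟨x, rfl⟩
  refine ⟨⟨⟨?_, fun h' => ?_⟩, fun J hJ hle => ?_⟩, fun C hC hCk => ?_⟩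
  · rw [Matroid.isFlat_iff_closure_eq]
    refine Subset.antisymm (fun x hx => ?_) (Matroid.subset_closure _ _ (subset_univ _))
    cases x with
    | some x => exact ⟨x, rfl⟩
    | none =>
      obtain ⟨I, hI⟩ := (coloopSumUniform k h hk hkh).exists_isBasis (range some)
        (subset_univ _)
      rw [← hI.closure_eq_closure, hI.indep.mem_closure_iff] at hx
      rcases hx with hx | hx
      · exact absurd (coloopSumUniform_indep_insert_none hI.indep) hx.not_indep
      · exact hI.subset hx
  · obtain ⟨x, hx⟩ := h'.symm.subset (mem_univ none)
    exact Option.some_ne_none x hx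
  · rintro (_ | x) hx
    · exact absurd (huniv J hx hle) hJ.2
    · exact ⟨x, rfl⟩
  · rw [coloopSumUniform_eRank] at hCk
    rw [Matroid.isCircuit_iff_dep_forall_sdiff_singleton_indep, Matroid.dep_iff,
      coloopSumUniform_indep_iff hC, hCk]
    refine ⟨⟨lt_irrefl _, subset_univ _⟩, fun x hx => ?_⟩
    rw [coloopSumUniform_indep_iff (sdiff_subset.trans hC), ← hCk]
    exact (toFinite _).encard_lt_encard (sdiff_singleton_ssubset.2 hx)

theorem coloopSumUniform_isSymmetric :
    IsSymmetric (Equiv.Perm (Fin h)) (coloopSumUniform k h hk hkh) := by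
  refine fun σ => ⟨smul_set_univ, ?_⟩
  rintro B ⟨hn, hB⟩
  exact ⟨⟨none, hn, rfl⟩, ((MulAction.injective σ).encard_image B).trans hB⟩

theorem perm_smul_range_some (σ : Equiv.Perm (Fin h)) :
    σ • (range some : Set (Option (Fin h))) = range some := by
  refine (range_comp (σ • ·) some).symm.trans ?_
  exact (σ.surjective.range_comp some)

/-- In the model the sum over fixed members of the orbit thus has a single term, so the change of
each polynomial has exactly the local contribution as its character. -/
theorem setOf_fixed_orbit_range_some (σ : Equiv.Perm (Fin h)) :
    {J | J ∈ MulAction.orbit (Equiv.Perm (Fin h)) (range some : Set (Option (Fin h))) ∧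
      σ • J = J} = {range some} := by
  ext J
  rw [mem_singleton_iff]
  constructor
  · rintro ⟨⟨τ, rfl⟩, -⟩
    exact perm_smul_range_some τ
  · rintro rfl
    exact ⟨MulAction.mem_orbit_self _, perm_smul_range_some σ⟩

end Model

/-! ### Comparing a stressed hyperplane with the model -/

section Transport

variable {α : Type*} {W : Type} [Group W] [MulAction W α] {H : Set α} {h : ℕ}

open scoped Classical in
/-- The extension of an ordering of `H` that maps the complement of `H` to `none`. -/
noncomputable def extendOrdering (e : H ≃ Fin h) (x : α) : Option (Fin h) :=
  if hx : x ∈ H then some (e ⟨x, hx⟩) else none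

theorem extendOrdering_of_mem (e : H ≃ Fin h) {x : α} (hx : x ∈ H) :
    extendOrdering e x = some (e ⟨x, hx⟩) := dif_pos hx

theorem injOn_extendOrdering (e : H ≃ Fin h) : InjOn (extendOrdering e) H := by
  intro x hx y hy hxy
  rw [extendOrdering_of_mem e hx, extendOrdering_of_mem e hy] at hxy
  simpa using hxy

theorem image_extendOrdering (e : H ≃ Fin h) : extendOrdering e '' H = range some := by
  ext y
  constructor
  · rintro ⟨x, hx, rfl⟩
    exact ⟨_, (extendOrdering_of_mem e hx).symm⟩
  · rintro ⟨i, rfl⟩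
    refine ⟨e.symm i, (e.symm i).2, ?_⟩
    rw [extendOrdering_of_mem e (e.symm i).2]
    simp

theorem mapsTo_of_smul_eq {w : W} (hw : w • H = H) : MapsTo (w • ·) H H :=
  mapsTo_iff_image_subset.2 hw.subset

theorem extendOrdering_smul (e : H ≃ Fin h) (u : MulAction.stabilizer W H) {x : α} (hx : x ∈ H) :
    extendOrdering e ((u : W) • x) = stabToPerm H e u • extendOrdering e x := by
  have hu : (u : W) • x ∈ H := mapsTo_of_smul_eq u.2 hx
  rw [extendOrdering_of_mem e hx, extendOrdering_of_mem e hu, Option.smul_some]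
  simp only [stabToPerm, Equiv.Perm.smul_def]
  congr 1
  change _ = e ((MulAction.toPerm u) (e.symm (e ⟨x, hx⟩)))
  rw [e.symm_apply_apply]
  rfl

theorem relKL_stabToPerm (e : H ≃ Fin h) (k : ℕ) (u : MulAction.stabilizer W H) :
    relKL (fun y : Option (Fin h) => stabToPerm H e u • y) k (range some) = relKL ((u : W) • ·) k H := by
  rw [← image_extendOrdering e]
  exact relKL_image (injOn_extendOrdering e) (mapsTo_of_smul_eq u.2)
    (MulAction.injective (u : W)).injOn fun x hx => extendOrdering_smul e u hx

theorem relRest_stabToPerm (e : H ≃ Fin h) (k : ℕ) (u : MulAction.stabilizer W H) :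
    relRest (fun y : Option (Fin h) => stabToPerm H e u • y) k (range some) = relRest ((u : W) • ·) k H := by
  rw [← image_extendOrdering e]
  exact relRest_image (injOn_extendOrdering e) (mapsTo_of_smul_eq u.2)
    (MulAction.injective (u : W)).injOn fun x hx => extendOrdering_smul e u hx

/-- By `hM` the restriction to `H` is uniform of rank `k - 1`, so the ordering identifies it with
the restriction of the model. -/
theorem relInv_stabToPerm (e : H ≃ Fin h) {k : ℕ} (hk : 1 ≤ k) (hkh : k ≤ h) {M : Matroid α}
    (hM : ∀ I ⊆ H, M.Indep I ↔ I.encard < k) (u : MulAction.stabilizer W H) :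
    relInv (fun y : Option (Fin h) => stabToPerm H e u • y) k
      ((coloopSumUniform k h hk hkh).restrict (range some)) =
      relInv ((u : W) • ·) k (M.restrict H) := by
  have he : InjOn (extendOrdering e) (M.restrict H).E := injOn_extendOrdering e
  have hmap : (coloopSumUniform k h hk hkh).restrict (range some) =
      (M.restrict H).map (extendOrdering e) he := by
    refine Matroid.ext_indep (image_extendOrdering e).symm fun I hI => ?_
    have hI' : I ⊆ extendOrdering e '' H := hI.trans (image_extendOrdering e).symm.subset
    obtain ⟨J, hJ, rfl⟩ := subset_image_iff.1 hI'
    rw [Matroid.restrict_indep_iff, Matroid.map_image_indep_iff (M := M.restrict H) hJ, Matroid.restrict_indep_iff,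
      coloopSumUniform_indep_iff hI, hM J hJ, ((injOn_extendOrdering e).mono hJ).encard_image]
    exact and_congr_right fun _ => ⟨fun _ => hJ, fun _ => hI⟩
  have hfin : Finite H := .of_equiv _ e.symm
  rw [hmap]
  exact relInv_map (N := M.restrict H) H.toFinite he (mapsTo_of_smul_eq u.2)
    (MulAction.injective (u : W)).injOn fun x hx => extendOrdering_smul e u hx

theorem relKL_conj (k : ℕ) (x : W) {g : W} (hg : g • H = H) :
    relKL ((x * g * x⁻¹) • ·) k (x • H) = relKL (g • ·) k H :=
  relKL_image (e := (x • ·)) (MulAction.injective x).injOn (mapsTo_of_smul_eq hg)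
    (MulAction.injective g).injOn fun y _ => by simp [mul_smul]

theorem relRest_conj (k : ℕ) (x : W) {g : W} (hg : g • H = H) :
    relRest ((x * g * x⁻¹) • ·) k (x • H) = relRest (g • ·) k H :=
  relRest_image (e := (x • ·)) (MulAction.injective x).injOn (mapsTo_of_smul_eq hg)
    (MulAction.injective g).injOn fun y _ => by simp [mul_smul]

theorem relInv_conj {M : Matroid α} [M.Finite] (hW : IsSymmetric W M) (hH : H ⊆ M.E) (k : ℕ)
    (x : W) {g : W} (hg : g • H = H) :
    relInv ((x * g * x⁻¹) • ·) k (M.restrict (x • H)) = relInv (g • ·) k (M.restrict H) := by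
  rw [hW.restrict_smul hH x]
  exact relInv_map (M.ground_finite.subset hH) _ (mapsTo_of_smul_eq hg)
    (MulAction.injective g).injOn fun y _ => by simp [mul_smul]

end Transport

end EquivariantKL

open EquivariantKL

theorem theorem1p1 (k h : ℕ) (hk : 1 ≤ k) (hkh : k ≤ h) :
    ∃ p q z : (EquivariantKL.VRep (Equiv.Perm (Fin h)))[X],
      ∀ (α : Type u) (M : Matroid α) [M.Finite] (W : Type) [Group W] [Finite W] [MulAction W α]
        (H : Set α) (e : H ≃ Fin h) (hW : EquivariantKL.IsSymmetric W M)
        (hH : EquivariantKL.IsStressedHyperplane M H),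
        EquivariantKL.rank M = k →
          let M' := EquivariantKL.relax M (MulAction.orbit W H)
            (hW.isStressedHyperplane_of_mem_orbit hH)
          EquivariantKL.klPoly W M' =
              EquivariantKL.klPoly W M + EquivariantKL.indRes H e p ∧
          EquivariantKL.invKlPoly W M' =
              EquivariantKL.invKlPoly W M + EquivariantKL.indRes H e q ∧
          EquivariantKL.zPoly W M' =
              EquivariantKL.zPoly W M + EquivariantKL.indRes H e z := by
  let S := Equiv.Perm (Fin h)
  let N := coloopSumUniform k h hk hkh
  have hN : IsSymmetric S N := coloopSumUniform_isSymmetric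
  have hR : IsStressedHyperplane N (Set.range some) := coloopSumUniform_isStressedHyperplane
  have hNk : rank N = k := by rw [rank, coloopSumUniform_eRank, ENat.toNat_natCast]
  have hRk : (k : ℕ∞) ≤ (Set.range (some : Fin h → _)).encard := by
    rw [encard_range_some]
    exact_mod_cast hkh
  let N' := relax N (MulAction.orbit S (Set.range some)) (hN.isStressedHyperplane_of_mem_orbit hR)
  -- The universal polynomials are the changes in the model. Taking differences of actual
  -- equivariant polynomials guarantees that the local contributions are characters of virtual
  -- representations.
  refine ⟨klPoly S N' - klPoly S N, invKlPoly S N' - invKlPoly S N, zPoly S N' - zPoly S N, ?_⟩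
  intro α M _ W _ _ _ H e hW hH hMk M'
  have hHk : (k : ℕ∞) ≤ H.encard := by
    rw [Set.encard, ENat.card_congr e, ENat.card_eq_coe_fintype_card, Fintype.card_fin]
    exact_mod_cast hkh
  have hHE : H ⊆ M.E := hH.1.prop.1.subset_ground
  refine ⟨?_, ?_, ?_⟩
  · rw [← sub_eq_iff_eq_add']
    refine ext_charPoly fun w => ?_
    -- Both sides become the same sum over the `w`-fixed members of the orbit. What remains is that
    -- the local term is the character of the model's change pulled back to the stabilizer, and that
    -- it is invariant under conjugation.
    rw [charPoly_klPoly_relax hW hH hk hMk hHk, charPoly_indRes e _ fun J w => relKL (w • ·) k J]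
    · intro u
      rw [charPoly_klPoly_relax hN hR hk hNk hRk, setOf_fixed_orbit_range_some,
        finsum_mem_singleton, relKL_stabToPerm]
    · exact fun x g hg => relKL_conj k x hg
  · rw [← sub_eq_iff_eq_add']
    refine ext_charPoly fun w => ?_
    rw [charPoly_invKlPoly_relax hW hH hk hMk hHk,
      charPoly_indRes e _ fun J w => relInv (w • ·) k (M.restrict J)]
    · intro u
      rw [charPoly_invKlPoly_relax hN hR hk hNk hRk, setOf_fixed_orbit_range_some,
        finsum_mem_singleton, relInv_stabToPerm e hk hkh
          ((isRelaxation_relax_orbit hW hH hMk hHk).indep_iff H (MulAction.mem_orbit_self H))]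
    · exact fun x g hg => relInv_conj hW hHE k x hg
  · rw [← sub_eq_iff_eq_add']
    refine ext_charPoly fun w => ?_
    rw [charPoly_zPoly_relax hW hH hk hMk hHk,
      charPoly_indRes e _ fun J w => relKL (w • ·) k J + relRest (w • ·) k J]
    · intro u
      rw [charPoly_zPoly_relax hN hR hk hNk hRk, setOf_fixed_orbit_range_some,
        finsum_mem_singleton, relKL_stabToPerm, relRest_stabToPerm]
    · exact fun x g hg => by rw [relKL_conj k x hg, relRest_conj k x hg]
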